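/- Let $n,N\ge 0$ be integers and let $E$ be an $n$-dimensional operator space with underlying vector space $\mathbb C^n$, given by an injective linear map $\varphi:\mathbb C^n\to B(H)$ into the bounded operators on a Hilbert space $H$; for an $n$-tuple $A=(A_1,\dots,A_n)$ of $m\times m$ matrices put $\|A\|_{M_m(E)}=\|\sum_k A_k\otimes\varphi(e_k)\|$. Let $\Omega=\{z\in\mathbb C^n:\|\varphi(z)\|<1\}$ be the open unit ball of the underlying normed space. The dual operator space $E^*$ is $\mathbb C^n$ with the matrix norms $\|A\|_{M_m(E^*)}=\sup\|\sum_k A_k\otimes B_k\|$, the supremum being over all $l$ and all $n$-tuples $B$ of $l\times l$ matrices with $\|B\|_{M_l(E)}\le 1$. For an $n$-tuple $S=(S_1,\dots,S_n)$ of operators on a Hilbert space let $\sigma_S(z)=\sum_k z_kS_k$; the completely bounded norm $\|\sigma_S\|_{cb}$ for $E$ (respectively $E^*$) is the least $C\ge 0$ such that $\|\sum_k A_k\otimes S_k\|\le C\|A\|$ for all $m$ and all $A$ in $M_m(E)$ (respectively $M_m(E^*)$), and $\sigma_S$ is completely contractive if $\|\sigma_S\|_{cb}\le 1$. Let $UC^\infty(E)$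 be the algebra of all holomorphic functions $f:\Omega\to\mathbb C$ with $$\|f\|_{UC^\infty(E)}=\sup_S\|f(S)\|<\infty,$$ the supremum being over all $n$-tuples $S$ of commuting operators on a Hilbert space such that $\|\sigma_S\|_{cb}<1$ for $E^*$. Here $f(S)$ is given by the holomorphic functional calculus on $\Omega$: if $f=\sum_{d\ge 0}p_d$ is the expansion of $f$ in homogeneous polynomials on $\Omega$, then $f(S)=\sum_{d\ge 0}p_d(S)$, convergent in norm. **Theorem (Nevanlinna–Pick interpolation).** Let $\lambda_1,\dots,\lambda_N\in\Omega$, $\lambda_j=(\lambda_j^1,\dots,\lambda_j^n)$, and let $w_1,\dots,w_N\in\mathbb C$. There exists $f\in UC^\infty(E)$ with $\|f\|_{UC^\infty(E)}\le 1$ and $f(\lambda_j)=w_j$ for all $j=1,\dots,N$ if and only if there exist an integer $m\ge 0$, $m\times m$ complex matrices $T_1,\dots,T_n$ such that $\sigma_T$ is completely contractive for $E$, and row vectors $v_1,\dots,v_N\in\mathbb C^m$ such that $$1-w_i\overline{w_j}=v_i\Big[I-\sum_{k,l=1}^n\lambda_i^k\,\overline{\lambda_j^l}\,T_kT_l^*\Big]v_j^*\qquad\text{for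 all } i,j=1,\dots,N.$$ -/

import Mathlib

open scoped Matrix ComplexConjugate

noncomputable section

namespace OpSpace

universe u

/-- The operator on the Hilbert direct sum `H ⊕ ⋯ ⊕ H` (`m` copies) given by an `m × m` matrix of
operators on `H`: `(M x)_a = ∑ b, M a b (x b)`. -/
def blockOp {H : Type u} [NormedAddCommGroup H] [InnerProductSpace ℂ H] {m : ℕ}
    (M : Fin m → Fin m → (H →L[ℂ] H)) :
    PiLp 2 (fun _ : Fin m => H) →L[ℂ] PiLp 2 (fun _ : Fin m => H) :=
  ((PiLp.continuousLinearEquiv 2 ℂ (fun _ : Fin m => H)).symm :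
      (Fin m → H) →L[ℂ] PiLp 2 (fun _ : Fin m => H)) ∘L
    ContinuousLinearMap.pi (fun a => ∑ b, M a b ∘L PiLp.proj 2 (fun _ : Fin m => H) b)

/-- The norm `‖∑ k, A k ⊗ S k‖` of an operator on `ℂ^m ⊗ H = H^m`, for `m × m` matrices `A k` and
operators `S k` on `H`. -/
def tensorNorm {n m : ℕ} {H : Type u} [NormedAddCommGroup H] [InnerProductSpace ℂ H]
    (A : Fin n → Matrix (Fin m) (Fin m) ℂ) (S : Fin n → (H →L[ℂ] H)) : ℝ :=
  ‖blockOp (fun a b => ∑ k, A k a b • S k)‖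

/-- Matrices regarded as operators on `ℂ^m` with its Euclidean norm. -/
def matrixTuple {n m : ℕ} (B : Fin n → Matrix (Fin m) (Fin m) ℂ) (k : Fin n) :
    EuclideanSpace ℂ (Fin m) →L[ℂ] EuclideanSpace ℂ (Fin m) :=
  Matrix.toEuclideanCLM (𝕜 := ℂ) (B k)

/-- Matrix norms on `ℂ^n`: a size assigned to the elements of the spaces of `n`-tuples of `m × m` matrices, that is, on the spaces of
`m × m` matrices over `ℂ^n`, one for every `m`. -/
abbrev MatrixNorms (n : ℕ) : Type :=
  ∀ m : ℕ, (Fin n → Matrix (Fin m) (Fin m) ℂ) → ℝ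

/-- The map `σ_S : z ↦ ∑ k, z k • S k` has completely bounded norm at most `C` with respect to the
given matrix norms on `ℂ^n`. -/
def CBNormLE {n : ℕ} (ν : MatrixNorms n) {K : Type u} [NormedAddCommGroup K]
    [InnerProductSpace ℂ K] (S : Fin n → (K →L[ℂ] K)) (C : ℝ) : Prop :=
  ∀ (m : ℕ) (A : Fin n → Matrix (Fin m) (Fin m) ℂ), tensorNorm A S ≤ C * ν m A

/-- `σ_S` is completely contractive. -/
def CompletelyContractive {n : ℕ} (ν : MatrixNorms n) {K : Type u} [NormedAddCommGroup K]
    [InnerProductSpace ℂ K] (S : Fin n → (K →L[ℂ] K)) : Prop :=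
  CBNormLE ν S 1

/-- `σ_S` is strictly completely contractive: its completely bounded norm is less than `1`. -/
def StrictlyCompletelyContractive {n : ℕ} (ν : MatrixNorms n) {K : Type u} [NormedAddCommGroup K]
    [InnerProductSpace ℂ K] (S : Fin n → (K →L[ℂ] K)) : Prop :=
  ∃ r : ℝ, 0 ≤ r ∧ r < 1 ∧ CBNormLE ν S r

/-- The dual matrix norms: `A` has the completely bounded norm of the map into the `m × m` matrices
that it induces, the supremum of `‖∑ k, A k ⊗ B k‖` over all `B` in the unit balls of the given
matrix norms, of all sizes `l`. -/
def dualNorms {n : ℕ} (ν : MatrixNorms n) : MatrixNorms n := fun _ A =>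
  sSup {r : ℝ | ∃ (l : ℕ) (B : Fin n → Matrix (Fin l) (Fin l) ℂ),
    ν l B ≤ 1 ∧ r = tensorNorm A (matrixTuple B)}

/-- The value of a polynomial at a commuting tuple of operators: every monomial `z^α` is replaced
by `S_1^{α_1} ⋯ S_n^{α_n}`. -/
def polyEval {n : ℕ} {K : Type u} [NormedAddCommGroup K] [InnerProductSpace ℂ K]
    (p : MvPolynomial (Fin n) ℂ) (S : Fin n → (K →L[ℂ] K)) : K →L[ℂ] K :=
  ∑ α ∈ p.support, p.coeff α • (List.ofFn fun k => S k ^ α k).prod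

/-- `∑ d, p d` is the expansion of `f` in homogeneous polynomials on `Ω`. -/
def IsHomogeneousExpansion {n : ℕ} (Ω : Set (Fin n → ℂ)) (f : (Fin n → ℂ) → ℂ)
    (p : ℕ → MvPolynomial (Fin n) ℂ) : Prop :=
  (∀ d, (p d).IsHomogeneous d) ∧ ∀ z ∈ Ω, HasSum (fun d => MvPolynomial.eval z (p d)) (f z)

/-- `f(S) = X` in the holomorphic functional calculus on the balanced domain `Ω`:
`X` is the sum, in operator norm, of the homogeneous expansion of `f`, evaluated at `S`. -/
def HasValueAt {n : ℕ} (Ω : Set (Fin n → ℂ)) (f : (Fin n → ℂ) → ℂ)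
    {K : Type u} [NormedAddCommGroup K] [InnerProductSpace ℂ K]
    (S : Fin n → (K →L[ℂ] K)) (X : K →L[ℂ] K) : Prop :=
  ∃ p : ℕ → MvPolynomial (Fin n) ℂ, IsHomogeneousExpansion Ω f p ∧
    HasSum (fun d => polyEval (p d) S) X

/-- An `n`-dimensional operator space on `ℂ^n`: the linear embedding `φ : ℂ^n → B(H)` is recorded
by the operators `φ(e_k)`. The norm of `ℂ^n` is the one that makes `φ` isometric. -/
structure OperatorSpace (n : ℕ) (H : Type u) [NormedAddCommGroup H] [InnerProductSpace ℂ H] where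
  gen : Fin n → (H →L[ℂ] H)
  linearIndependent_gen : LinearIndependent ℂ gen

namespace OperatorSpace

variable {n : ℕ} {H : Type u} [NormedAddCommGroup H] [InnerProductSpace ℂ H]

/-- The matrix norms of the operator space. -/
def norms (E : OperatorSpace n H) : MatrixNorms n := fun _ A => tensorNorm A E.gen

/-- The open unit ball of the underlying Banach space. -/
def ball (E : OperatorSpace n H) : Set (Fin n → ℂ) := {z | ‖∑ k, z k • E.gen k‖ < 1}

/-- The commuting tuples on which the functions are tested: those which induce a strictly completely
contractive map of the dual operator space. -/
def IsTestTuple (E : OperatorSpace n H) {K : Type} [NormedAddCommGroup K] [InnerProductSpace ℂ K]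
    (S : Fin n → (K →L[ℂ] K)) : Prop :=
  (∀ k l, Commute (S k) (S l)) ∧ StrictlyCompletelyContractive (dualNorms E.norms) S

/-- The algebra `UC^∞(E)`: the holomorphic functions `f` on the unit ball such that `‖f(S)‖` is
bounded over all test tuples `S`. -/
def UCInfty (E : OperatorSpace n H) : Set ((Fin n → ℂ) → ℂ) :=
  {f | DifferentiableOn ℂ f E.ball ∧
    ∃ C : ℝ, ∀ (K : Type) [NormedAddCommGroup K] [InnerProductSpace ℂ K] [CompleteSpace K]
      (S : Fin n → (K →L[ℂ] K)), E.IsTestTuple S →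
        ∃ X : K →L[ℂ] K, HasValueAt E.ball f S X ∧ ‖X‖ ≤ C}

/-- The norm of `UC^∞(E)`: the supremum of `‖f(S)‖` over all test tuples `S`. -/
def ucNorm (E : OperatorSpace n H) (f : (Fin n → ℂ) → ℂ) : ℝ :=
  sSup {r : ℝ | ∃ (K : Type) (_ : NormedAddCommGroup K) (_ : InnerProductSpace ℂ K)
    (_ : CompleteSpace K) (S : Fin n → (K →L[ℂ] K)) (X : K →L[ℂ] K),
      E.IsTestTuple S ∧ HasValueAt E.ball f S X ∧ r = ‖X‖}

end OperatorSpace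

end OpSpace

end

/-! Write T(z) = ∑ z_k T_k. The kernel identity says that the vectors (1, v_i T(λ_i)) and (w_i, v_i)
of ℂ^(m+1) have the same Gram matrix.

Sufficiency. By `exists_colligation` an isometric matrix U carries the first family to the second.
Its transfer function f(z) = U₀₀ + U₀₁(1 − T(z)U₁₁)⁻¹T(z)U₁₀ then takes the value w_i at λ_i
(`transferFun_eq_of_vecMul`). Since σ_T is completely contractive for E, the tuple T lies in the
unit ball of M_m(E*), so ‖∑ T_k ⊗ S_k‖ < 1 for every test tuple S. The energy balance of U now gives
‖f(S)‖ ≤ 1 (`exists_hasSum_transferPoly`).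

Necessity. The kernels u_i*[1 − T(λ_i)T(λ_j)*]u_j with σ_T completely contractive form a closed
convex cone, `pickCone`. If the matrix (1 − f(λ_i) conj f(λ_j)) were outside it,
`exists_gram_separation` would give a positive definite B*B that is nonnegative on the cone and
negative on this matrix. Let S be the commuting tuple whose adjoints have the columns b_i of B as
joint eigenvectors: S_k* b_i = conj(λ_i^k) b_i. Nonnegativity on the cone makes ∑ A_k ⊗ S_k a
contraction for every matrix tuple A completely contractive for E, so S is completely contractive
for E* (`completelyContractive_conjDiagonalOp`). Approximating S by rS with r < 1 shows that f(S) is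
a contraction. But f(S)* b_i = conj(f(λ_i)) b_i, and testing f(S)* on ∑ b_i contradicts the
separation. -/

open scoped InnerProductSpace

noncomputable section

namespace OpSpace

/-! ### Norms of tensor products of matrix tuples with operator tuples -/

section Tensor

variable {n m : ℕ} {K K' : Type*} [NormedAddCommGroup K] [InnerProductSpace ℂ K]
  [NormedAddCommGroup K'] [InnerProductSpace ℂ K']

theorem blockOp_apply (M : Fin m → Fin m → (K →L[ℂ] K)) (x : PiLp 2 (fun _ : Fin m => K))
    (a : Fin m) : blockOp M x a = ∑ b, M a b (x b) := by
  simp [blockOp]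

theorem blockOp_tensor_apply (A : Fin n → Matrix (Fin m) (Fin m) ℂ) (S : Fin n → (K →L[ℂ] K))
    (x : PiLp 2 (fun _ : Fin m => K)) (a : Fin m) :
    blockOp (fun a b => ∑ k, A k a b • S k) x a = ∑ b, ∑ k, A k a b • S k (x b) := by
  simp [blockOp_apply]

theorem tensorNorm_nonneg (A : Fin n → Matrix (Fin m) (Fin m) ℂ) (S : Fin n → (K →L[ℂ] K)) :
    0 ≤ tensorNorm A S := ContinuousLinearMap.opNorm_nonneg _

theorem tensorNorm_le_iff {A : Fin n → Matrix (Fin m) (Fin m) ℂ} {S : Fin n → (K →L[ℂ] K)}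
    {C : ℝ} (hC : 0 ≤ C) :
    tensorNorm A S ≤ C ↔ ∀ x : Fin m → K,
      ∑ a, ‖∑ b, ∑ k, A k a b • S k (x b)‖ ^ 2 ≤ C ^ 2 * ∑ b, ‖x b‖ ^ 2 := by
  rw [tensorNorm, ContinuousLinearMap.opNorm_le_iff hC]
  have key : ∀ x : PiLp 2 (fun _ : Fin m => K),
      (‖blockOp (fun a b => ∑ k, A k a b • S k) x‖ ≤ C * ‖x‖ ↔
        ∑ a, ‖∑ b, ∑ k, A k a b • S k (x b)‖ ^ 2 ≤ C ^ 2 * ∑ b, ‖x b‖ ^ 2) := by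
    intro x
    rw [← sq_le_sq₀ (norm_nonneg _) (by positivity), mul_pow, PiLp.norm_sq_eq_of_L2,
      PiLp.norm_sq_eq_of_L2]
    simp only [blockOp_tensor_apply]
  exact ⟨fun h x => (key (WithLp.toLp 2 x)).1 (h _), fun h x => (key x).2 (h _)⟩

theorem sum_norm_sq_le_tensorNorm (A : Fin n → Matrix (Fin m) (Fin m) ℂ)
    (S : Fin n → (K →L[ℂ] K)) (x : Fin m → K) :
    ∑ a, ‖∑ b, ∑ k, A k a b • S k (x b)‖ ^ 2 ≤ tensorNorm A S ^ 2 * ∑ b, ‖x b‖ ^ 2 :=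
  (tensorNorm_le_iff (tensorNorm_nonneg A S)).1 le_rfl x

theorem tensorNorm_smul_right (c : ℂ) (A : Fin n → Matrix (Fin m) (Fin m) ℂ)
    (S : Fin n → (K →L[ℂ] K)) : tensorNorm A (fun k => c • S k) = ‖c‖ * tensorNorm A S := by
  have key : ∀ (c : ℂ) (S : Fin n → (K →L[ℂ] K)),
      tensorNorm A (fun k => c • S k) ≤ ‖c‖ * tensorNorm A S := by
    intro c S
    rw [tensorNorm_le_iff (mul_nonneg (norm_nonneg _) (tensorNorm_nonneg A S))]
    intro x
    have h : ∀ a, ‖∑ b, ∑ k, A k a b • (c • S k) (x b)‖ ^ 2 =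
        ‖c‖ ^ 2 * ‖∑ b, ∑ k, A k a b • S k (x b)‖ ^ 2 := by
      intro a
      rw [← mul_pow, ← norm_smul]
      simp only [smul_apply, Finset.smul_sum, smul_comm c]
    simp only [h]
    rw [← Finset.mul_sum, mul_pow, mul_assoc]
    gcongr
    exact sum_norm_sq_le_tensorNorm A S x
  refine le_antisymm (key c S) ?_
  rcases eq_or_ne c 0 with rfl | hc
  · simpa using tensorNorm_nonneg A fun k => (0 : ℂ) • S k
  · have := key c⁻¹ fun k => c • S k
    simp only [smul_smul, inv_mul_cancel₀ hc, one_smul, norm_inv] at this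
    rwa [← le_inv_mul_iff₀ (norm_pos_iff.2 hc)]

theorem tensorNorm_smul_left (c : ℂ) (A : Fin n → Matrix (Fin m) (Fin m) ℂ)
    (S : Fin n → (K →L[ℂ] K)) : tensorNorm (fun k => c • A k) S = ‖c‖ * tensorNorm A S := by
  rw [← tensorNorm_smul_right]
  simp only [tensorNorm, Matrix.smul_apply, smul_eq_mul, mul_smul, smul_comm c]

theorem matrixTuple_smul (c : ℂ) (B : Fin n → Matrix (Fin m) (Fin m) ℂ) :
    matrixTuple (fun k => c • B k) = fun k => c • matrixTuple B k := by
  funext k; simp [matrixTuple]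

theorem matrixTuple_apply (B : Fin n → Matrix (Fin m) (Fin m) ℂ) (k : Fin n)
    (x : EuclideanSpace ℂ (Fin m)) (s : Fin m) :
    matrixTuple B k x s = ∑ t, B k s t * x t := by
  rw [matrixTuple, Matrix.ofLp_toEuclideanCLM]
  rfl

theorem tensorNorm_matrixTuple_le_iff {l : ℕ} {A : Fin n → Matrix (Fin m) (Fin m) ℂ}
    {B : Fin n → Matrix (Fin l) (Fin l) ℂ} {C : ℝ} (hC : 0 ≤ C) :
    tensorNorm A (matrixTuple B) ≤ C ↔ ∀ x : Fin m → Fin l → ℂ,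
      ∑ a, ∑ s, ‖∑ b, ∑ t, ∑ k, A k a b * B k s t * x b t‖ ^ 2 ≤
        C ^ 2 * ∑ b, ∑ t, ‖x b t‖ ^ 2 := by
  rw [tensorNorm_le_iff hC]
  have key : ∀ x : Fin m → EuclideanSpace ℂ (Fin l),
      (∑ a, ‖∑ b, ∑ k, A k a b • matrixTuple B k (x b)‖ ^ 2 ≤ C ^ 2 * ∑ b, ‖x b‖ ^ 2 ↔
        ∑ a, ∑ s, ‖∑ b, ∑ t, ∑ k, A k a b * B k s t * x b t‖ ^ 2 ≤
          C ^ 2 * ∑ b, ∑ t, ‖x b t‖ ^ 2) := by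
    intro x
    simp only [EuclideanSpace.norm_sq_eq, WithLp.ofLp_sum, Finset.sum_apply, PiLp.smul_apply,
      matrixTuple_apply, smul_eq_mul, Finset.mul_sum, mul_assoc]
    have : ∀ a s, (∑ b, ∑ t, ∑ k, A k a b * (B k s t * x b t)) =
        ∑ b, ∑ k, ∑ t, A k a b * (B k s t * x b t) := fun a s =>
      Finset.sum_congr rfl fun b _ => Finset.sum_comm
    simp only [this]
  exact ⟨fun h x => (key fun b => WithLp.toLp 2 (x b)).1 (h _), fun h x => (key x).2 (h _)⟩

/-- The flip of ℂ^m ⊗ ℂ^l is unitary and exchanges the two factors. This symmetry is what lets the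
roles of E and E* be interchanged. -/
theorem tensorNorm_flip {l : ℕ} (A : Fin n → Matrix (Fin m) (Fin m) ℂ)
    (B : Fin n → Matrix (Fin l) (Fin l) ℂ) :
    tensorNorm A (matrixTuple B) = tensorNorm B (matrixTuple A) := by
  have key : ∀ {m l : ℕ} (A : Fin n → Matrix (Fin m) (Fin m) ℂ)
      (B : Fin n → Matrix (Fin l) (Fin l) ℂ),
      tensorNorm A (matrixTuple B) ≤ tensorNorm B (matrixTuple A) := by
    intro m l A B
    rw [tensorNorm_matrixTuple_le_iff (tensorNorm_nonneg _ _)]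
    intro x
    have := (tensorNorm_matrixTuple_le_iff (tensorNorm_nonneg B (matrixTuple A))).1 le_rfl
      (fun t b => x b t)
    rw [Finset.sum_comm, Finset.sum_comm (f := fun b t => ‖x b t‖ ^ 2)]
    refine le_of_eq_of_le (Finset.sum_congr rfl fun s _ => Finset.sum_congr rfl fun a _ => ?_) this
    rw [Finset.sum_comm]
    simp only [mul_comm (A _ _ _)]
  exact le_antisymm (key A B) (key B A)

theorem tensorNorm_compress_le (A : Fin n → Matrix (Fin m) (Fin m) ℂ) (S : Fin n → (K →L[ℂ] K))
    (W : K →L[ℂ] K') (V : K' →L[ℂ] K) (hW : ‖W‖ ≤ 1) (hV : ‖V‖ ≤ 1) :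
    tensorNorm A (fun k => W ∘L S k ∘L V) ≤ tensorNorm A S := by
  rw [tensorNorm_le_iff (tensorNorm_nonneg _ _)]
  intro x
  calc ∑ a, ‖∑ b, ∑ k, A k a b • (W ∘L S k ∘L V) (x b)‖ ^ 2
      = ∑ a, ‖W (∑ b, ∑ k, A k a b • S k (V (x b)))‖ ^ 2 := by simp [map_sum]
    _ ≤ ∑ a, ‖∑ b, ∑ k, A k a b • S k (V (x b))‖ ^ 2 := by
        gcongr
        exact W.le_of_opNorm_le hW _ |>.trans_eq (one_mul _)
    _ ≤ tensorNorm A S ^ 2 * ∑ b, ‖V (x b)‖ ^ 2 := sum_norm_sq_le_tensorNorm A S _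
    _ ≤ _ := by
        gcongr
        exact V.le_of_opNorm_le hV _ |>.trans_eq (one_mul _)

theorem tensorNorm_le_sum (A : Fin n → Matrix (Fin m) (Fin m) ℂ) (S : Fin n → (K →L[ℂ] K)) :
    tensorNorm A S ≤ ∑ a, ∑ b, ∑ k, ‖A k a b‖ * ‖S k‖ := by
  refine ContinuousLinearMap.opNorm_le_bound _ (by positivity) fun x => ?_
  calc ‖blockOp (fun a b => ∑ k, A k a b • S k) x‖
      ≤ ∑ a, ‖blockOp (fun a b => ∑ k, A k a b • S k) x a‖ := by
        rw [PiLp.norm_eq_of_L2, Real.sqrt_le_left (by positivity)]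
        exact Finset.sum_sq_le_sq_sum_of_nonneg fun _ _ => norm_nonneg _
    _ ≤ ∑ a, ∑ b, ∑ k, ‖A k a b‖ * ‖S k‖ * ‖x‖ := by
        gcongr with a
        rw [blockOp_tensor_apply]
        refine (norm_sum_le _ _).trans (Finset.sum_le_sum fun b _ => ?_)
        refine (norm_sum_le _ _).trans (Finset.sum_le_sum fun k _ => ?_)
        rw [norm_smul, mul_assoc]
        gcongr
        exact (S k).le_opNorm_of_le (PiLp.norm_apply_le x b)
    _ = _ := by simp only [Finset.sum_mul]

/-- The operator `∑ k, (η* A_k ξ) S_k` is a compression of `∑ k, A_k ⊗ S_k`. -/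
theorem norm_sum_dotProduct_smul_le (A : Fin n → Matrix (Fin m) (Fin m) ℂ)
    (S : Fin n → (K →L[ℂ] K)) (ξ η : EuclideanSpace ℂ (Fin m)) :
    ‖∑ k, (∑ a, ∑ b, η a * A k a b * ξ b) • S k‖ ≤ tensorNorm A S * ‖ξ‖ * ‖η‖ := by
  refine ContinuousLinearMap.opNorm_le_bound _
    (by have := tensorNorm_nonneg A S; positivity) fun x => ?_
  have h1 : (∑ k, (∑ a, ∑ b, η a * A k a b * ξ b) • S k) x =
      ∑ a, η a • ∑ b, ∑ k, A k a b • S k (ξ b • x) := by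
    simp only [sum_apply, smul_apply, Finset.sum_smul,
      Finset.smul_sum, map_smul, smul_smul]
    rw [Finset.sum_comm]
    refine Finset.sum_congr rfl fun a _ => ?_
    rw [Finset.sum_comm]
    simp only [mul_assoc]
  have h2 := sum_norm_sq_le_tensorNorm A S (fun b => ξ b • x)
  set y : Fin m → K := fun a => ∑ b, ∑ k, A k a b • S k (ξ b • x) with hy
  have h3 : ∑ b, ‖ξ b • x‖ ^ 2 = (‖ξ‖ * ‖x‖) ^ 2 := by
    simp only [norm_smul, mul_pow, EuclideanSpace.norm_sq_eq, Finset.sum_mul]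
  rw [h1]
  have h4 : (∑ a, ‖η a‖ * ‖y a‖) ^ 2 ≤ (tensorNorm A S * ‖ξ‖ * ‖η‖ * ‖x‖) ^ 2 := by
    refine (Finset.sum_mul_sq_le_sq_mul_sq _ _ _).trans ?_
    rw [← EuclideanSpace.norm_sq_eq]
    rw [h3] at h2
    calc ‖η‖ ^ 2 * ∑ a, ‖y a‖ ^ 2 ≤ ‖η‖ ^ 2 * (tensorNorm A S ^ 2 * (‖ξ‖ * ‖x‖) ^ 2) := by gcongr
      _ = _ := by ring
  have h5 := abs_le_of_sq_le_sq h4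
    (by have := tensorNorm_nonneg A S; positivity)
  refine (norm_sum_le _ _).trans (le_trans ?_ ((le_abs_self _).trans h5))
  simp [norm_smul, hy]

end Tensor

/-! ### Polynomials of commuting tuples and uniqueness of homogeneous expansions -/

section FunctionalCalculus

variable {n : ℕ} {K : Type*} [NormedAddCommGroup K] [InnerProductSpace ℂ K]

theorem polyEval_eq_algHom {S : Fin n → (K →L[ℂ] K)}
    (ψ : MvPolynomial (Fin n) ℂ →ₐ[ℂ] (K →L[ℂ] K)) (hψ : ∀ k, ψ (MvPolynomial.X k) = S k)
    (p : MvPolynomial (Fin n) ℂ) : polyEval p S = ψ p := by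
  conv_rhs => rw [p.as_sum, map_sum]
  refine Finset.sum_congr rfl fun α _ => ?_
  have h : MvPolynomial.monomial α (p.coeff α) =
      p.coeff α • (List.ofFn fun k => (MvPolynomial.X k : MvPolynomial (Fin n) ℂ) ^ α k).prod := by
    rw [List.prod_ofFn, MvPolynomial.monomial_eq, MvPolynomial.smul_eq_C_mul,
      Finsupp.prod_fintype _ _ fun i => pow_zero _]
  rw [h, map_smul, map_list_prod, List.map_ofFn]
  simp only [Function.comp_def, map_pow, hψ]

open scoped IsMulCommutative in
theorem exists_algHom_of_commute {S : Fin n → (K →L[ℂ] K)} (hS : ∀ k l, Commute (S k) (S l)) :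
    ∃ ψ : MvPolynomial (Fin n) ℂ →ₐ[ℂ] (K →L[ℂ] K), ∀ k, ψ (MvPolynomial.X k) = S k := by
  have := Algebra.isMulCommutative_adjoin ℂ (s := Set.range S)
    (by rintro _ ⟨k, rfl⟩ _ ⟨l, rfl⟩; exact hS k l)
  exact ⟨(Algebra.adjoin ℂ (Set.range S)).val.comp (MvPolynomial.aeval
    fun k => ⟨S k, Algebra.subset_adjoin ⟨k, rfl⟩⟩), fun k => by simp⟩

theorem _root_.MvPolynomial.IsHomogeneous.eval_smul {σ R : Type*} [CommSemiring R]
    {p : MvPolynomial σ R} {d : ℕ} (hp : p.IsHomogeneous d) (c : R) (z : σ → R) :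
    MvPolynomial.eval (c • z) p = c ^ d * MvPolynomial.eval z p := by
  rw [MvPolynomial.eval_eq, MvPolynomial.eval_eq, Finset.mul_sum]
  refine Finset.sum_congr rfl fun α hα => ?_
  have h := hp (MvPolynomial.mem_support_iff.1 hα)
  rw [Finsupp.weight_apply, Finsupp.sum] at h
  simp only [Pi.one_apply, smul_eq_mul, mul_one] at h
  simp only [Pi.smul_apply, smul_eq_mul, mul_pow, Finset.prod_mul_distrib, Finset.prod_pow_eq_pow_sum]
  rw [h]
  ring

/-- A function has at most one expansion in homogeneous polynomials on a balanced absorbing set. -/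
theorem IsHomogeneousExpansion.unique {Ω : Set (Fin n → ℂ)}
    (hbal : ∀ z ∈ Ω, ∀ c : ℂ, ‖c‖ ≤ 1 → c • z ∈ Ω)
    (habs : ∀ z, ∃ c : ℂ, c ≠ 0 ∧ c • z ∈ Ω) {f : (Fin n → ℂ) → ℂ}
    {p q : ℕ → MvPolynomial (Fin n) ℂ} (hp : IsHomogeneousExpansion Ω f p)
    (hq : IsHomogeneousExpansion Ω f q) : p = q := by
  have hΩ : ∀ z ∈ Ω, ∀ d, MvPolynomial.eval z (p d) = MvPolynomial.eval z (q d) := by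
    intro z hz
    have hps : ∀ {r : ℕ → MvPolynomial (Fin n) ℂ}, IsHomogeneousExpansion Ω f r →
        -- On the complex line through z a homogeneous expansion becomes a power series in c, whose
        -- coefficients are unique. Homogeneity then carries the equality from Ω to all of ℂ^n,
        -- because Ω is absorbing.
        HasFPowerSeriesAt (fun c : ℂ => f (c • z))
          (FormalMultilinearSeries.ofScalars ℂ fun d => MvPolynomial.eval z (r d)) 0 := by
      intro r hr
      rw [hasFPowerSeriesAt_iff']
      filter_upwards [Metric.ball_mem_nhds (0 : ℂ) one_pos] with c hc
      rw [mem_ball_zero_iff] at hc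
      simpa [FormalMultilinearSeries.coeff_ofScalars, (hr.1 _).eval_smul] using
        hr.2 _ (hbal z hz c hc.le)
    have := (hps hp).eq_formalMultilinearSeries (hps hq)
    intro d
    exact congrFun (FormalMultilinearSeries.ofScalars_series_injective ℂ ℂ this) d
  funext d
  refine MvPolynomial.funext fun z => ?_
  obtain ⟨c, hc, hcz⟩ := habs z
  have := hΩ _ hcz d
  rw [(hp.1 d).eval_smul, (hq.1 d).eval_smul] at this
  exact mul_left_cancel₀ (pow_ne_zero d hc) this

end FunctionalCalculus

/-! ### Matrix norms of an operator space and of its dual -/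

namespace OperatorSpace

universe u

variable {n m : ℕ} {H : Type u} [NormedAddCommGroup H] [InnerProductSpace ℂ H]
  (E : OperatorSpace n H)

theorem sum_smul_smul_gen (c : ℂ) (z : Fin n → ℂ) :
    ∑ k, (c • z) k • E.gen k = c • ∑ k, z k • E.gen k := by
  simp [Finset.smul_sum, mul_smul]

theorem smul_mem_ball {z : Fin n → ℂ} (hz : z ∈ E.ball) {c : ℂ} (hc : ‖c‖ ≤ 1) :
    c • z ∈ E.ball := by
  rw [ball, Set.mem_ofPred_eq, sum_smul_smul_gen, norm_smul]
  exact (mul_le_of_le_one_left (norm_nonneg _) hc).trans_lt hz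

theorem exists_smul_mem_ball (z : Fin n → ℂ) : ∃ c : ℂ, c ≠ 0 ∧ c • z ∈ E.ball := by
  obtain ⟨ε, hε, h⟩ := exists_pos_mul_lt one_pos ‖∑ k, z k • E.gen k‖
  refine ⟨ε, by exact_mod_cast hε.ne', ?_⟩
  rw [ball, Set.mem_ofPred_eq, sum_smul_smul_gen, norm_smul, Complex.norm_real, Real.norm_eq_abs,
    abs_of_pos hε, mul_comm]
  exact h

theorem isOpen_ball : IsOpen E.ball :=
  isOpen_lt (by fun_prop) continuous_const

theorem hasValueAt_unique {K : Type*} [NormedAddCommGroup K] [InnerProductSpace ℂ K]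
    {f : (Fin n → ℂ) → ℂ} {S : Fin n → (K →L[ℂ] K)} {X Y : K →L[ℂ] K}
    (hX : HasValueAt E.ball f S X) (hY : HasValueAt E.ball f S Y) : X = Y := by
  obtain ⟨p, hp, hpX⟩ := hX
  obtain ⟨q, hq, hqY⟩ := hY
  obtain rfl := hp.unique (fun z hz c hc => E.smul_mem_ball hz hc) E.exists_smul_mem_ball hq
  exact hpX.unique hqY

/-- Membership in `UCInfty` bounds one value at each test tuple. Since values are unique, it bounds
them all, so the `sSup` is a genuine supremum and not the default value of an unbounded set. -/
theorem norm_le_ucNorm {f : (Fin n → ℂ) → ℂ} (hf : f ∈ E.UCInfty) {K : Type}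
    [NormedAddCommGroup K] [InnerProductSpace ℂ K] [CompleteSpace K] {S : Fin n → (K →L[ℂ] K)}
    (hS : E.IsTestTuple S) {X : K →L[ℂ] K} (hX : HasValueAt E.ball f S X) : ‖X‖ ≤ E.ucNorm f := by
  obtain ⟨-, C, hC⟩ := hf
  refine le_csSup ⟨C, ?_⟩ ⟨K, _, _, ‹_›, S, X, hS, hX, rfl⟩
  rintro _ ⟨K, _, _, _, S, X, hS, hX, rfl⟩
  obtain ⟨Y, hY, hYC⟩ := hC K S hS
  rwa [E.hasValueAt_unique hX hY]

theorem norms_smul (c : ℂ) (A : Fin n → Matrix (Fin m) (Fin m) ℂ) :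
    E.norms m (fun k => c • A k) = ‖c‖ * E.norms m A := tensorNorm_smul_left c A E.gen

theorem norms_nonneg (A : Fin n → Matrix (Fin m) (Fin m) ℂ) : 0 ≤ E.norms m A :=
  tensorNorm_nonneg _ _

/-- The coefficients of an element of `M_m(E)` are bounded by its norm, uniformly in `m`. -/
theorem exists_norm_matrixTuple_le : ∃ C : ℝ, 0 ≤ C ∧
    ∀ (m : ℕ) (A : Fin n → Matrix (Fin m) (Fin m) ℂ) (k : Fin n),
      ‖matrixTuple A k‖ ≤ C * E.norms m A := by
  have hker : LinearMap.ker (Fintype.linearCombination ℂ E.gen) = ⊥ :=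
    LinearMap.ker_eq_bot.2 (linearIndependent_iff_injective_fintypeLinearCombination.1
      E.linearIndependent_gen)
  obtain ⟨C, -, hC⟩ := LinearMap.exists_antilipschitzWith _ hker
  have hcoord : ∀ (z : Fin n → ℂ) k, ‖z k‖ ≤ C * ‖∑ k, z k • E.gen k‖ := fun z k =>
    (norm_le_pi_norm z k).trans (by
      simpa [Fintype.linearCombination_apply] using hC.le_mul_norm (map_zero _) z)
  refine ⟨C, C.2, fun m A k => ContinuousLinearMap.opNorm_le_bound _
    (mul_nonneg C.2 (E.norms_nonneg A)) fun ξ => ?_⟩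
  set y := matrixTuple A k ξ with hy
  -- With η the conjugate of y = A_k ξ, the k-th coefficient of the compression is ‖y‖². The
  -- coordinate bound at that single k suffices.
  set η : EuclideanSpace ℂ (Fin m) := WithLp.toLp 2 fun a => conj (y a) with hη
  have hηn : ‖η‖ = ‖y‖ := by simp [EuclideanSpace.norm_eq, hη]
  have h1 := (hcoord _ k).trans (mul_le_mul_of_nonneg_left
    (norm_sum_dotProduct_smul_le A E.gen ξ η) C.2)
  have h2 : ∑ a, ∑ b, η a * A k a b * ξ b = ((‖y‖ ^ 2 : ℝ) : ℂ) := by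
    rw [EuclideanSpace.norm_sq_eq]
    push_cast
    refine Finset.sum_congr rfl fun a _ => ?_
    simp only [mul_assoc, ← Finset.mul_sum, ← matrixTuple_apply, ← hy]
    simp [hη, Complex.conj_mul']
  rw [h2, Complex.norm_real, Real.norm_of_nonneg (sq_nonneg _), hηn, sq] at h1
  rcases (norm_nonneg y).eq_or_lt with h0 | h0
  · rw [← h0]
    exact mul_nonneg (mul_nonneg C.2 (E.norms_nonneg A)) (norm_nonneg _)
  · refine le_of_mul_le_mul_right (h1.trans_eq ?_) h0
    rw [norms]
    ring

theorem bddAbove_dualNorms (A : Fin n → Matrix (Fin m) (Fin m) ℂ) :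
    BddAbove {r : ℝ | ∃ (l : ℕ) (B : Fin n → Matrix (Fin l) (Fin l) ℂ),
      E.norms l B ≤ 1 ∧ r = tensorNorm A (matrixTuple B)} := by
  obtain ⟨C, hC, h⟩ := E.exists_norm_matrixTuple_le
  refine ⟨∑ a, ∑ b, ∑ k, ‖A k a b‖ * C, ?_⟩
  rintro _ ⟨l, B, hB, rfl⟩
  refine (tensorNorm_le_sum _ _).trans ?_
  gcongr with a _ b _ k _
  exact (h l B k).trans (mul_le_of_le_one_right hC hB)

theorem tensorNorm_le_dualNorms (A : Fin n → Matrix (Fin m) (Fin m) ℂ) {l : ℕ}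
    (B : Fin n → Matrix (Fin l) (Fin l) ℂ) :
    tensorNorm A (matrixTuple B) ≤ dualNorms E.norms m A * E.norms l B := by
  have hle : ∀ {l : ℕ} (B : Fin n → Matrix (Fin l) (Fin l) ℂ), E.norms l B ≤ 1 →
      tensorNorm A (matrixTuple B) ≤ dualNorms E.norms m A := fun B hB =>
    le_csSup (E.bddAbove_dualNorms A) ⟨_, B, hB, rfl⟩
  have hD : 0 ≤ dualNorms E.norms m A :=
    Real.sSup_nonneg fun _ ⟨_, _, _, h⟩ => h ▸ tensorNorm_nonneg _ _
  -- The norm of B may vanish, so B is rescaled by t⁻¹ for t above its norm, and then t decreases to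
  -- it.
  have key : ∀ t : ℝ, E.norms l B < t → tensorNorm A (matrixTuple B) ≤ dualNorms E.norms m A * t := by
    intro t ht
    have ht0 : 0 < t := (E.norms_nonneg B).trans_lt ht
    have hn : ‖((t⁻¹ : ℝ) : ℂ)‖ = t⁻¹ := by
      rw [Complex.norm_real, Real.norm_of_nonneg (by positivity)]
    have h1 := hle (fun k => ((t⁻¹ : ℝ) : ℂ) • B k) (by
      rw [norms_smul, hn, inv_mul_le_iff₀ ht0]; linarith)
    rw [matrixTuple_smul, tensorNorm_smul_right, hn, inv_mul_le_iff₀ ht0] at h1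
    linarith
  refine ge_of_tendsto (x := nhdsWithin (E.norms l B) (Set.Ioi (E.norms l B)))
    (f := fun t => dualNorms E.norms m A * t) ?_ (Filter.eventually_of_mem self_mem_nhdsWithin key)
  exact ((continuous_const.mul continuous_id).tendsto _).mono_left nhdsWithin_le_nhds

theorem dualNorms_le_one_of_completelyContractive {A : Fin n → Matrix (Fin m) (Fin m) ℂ}
    (hA : CompletelyContractive E.norms (matrixTuple A)) : dualNorms E.norms m A ≤ 1 := by
  refine Real.sSup_le ?_ zero_le_one
  rintro _ ⟨l, B, hB, rfl⟩
  rw [tensorNorm_flip]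
  exact (hA l B).trans (by rwa [one_mul])

/-- A tuple is completely contractive for `E*` if its tensor products with all matrix tuples that
are completely contractive for `E` are contractions. -/
theorem completelyContractive_dualNorms {K : Type*} [NormedAddCommGroup K] [InnerProductSpace ℂ K]
    {S : Fin n → (K →L[ℂ] K)}
    (hS : ∀ (m : ℕ) (A : Fin n → Matrix (Fin m) (Fin m) ℂ),
      CompletelyContractive E.norms (matrixTuple A) → tensorNorm A S ≤ 1) :
    CompletelyContractive (dualNorms E.norms) S := by
  intro m A
  rw [one_mul]
  refine le_of_forall_gt_imp_ge_of_dense fun t ht => ?_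
  have hD : 0 ≤ dualNorms E.norms m A :=
    Real.sSup_nonneg fun _ ⟨_, _, _, h⟩ => h ▸ tensorNorm_nonneg _ _
  have ht0 : 0 < t := hD.trans_lt ht
  have hn : ‖((t⁻¹ : ℝ) : ℂ)‖ = t⁻¹ := by
    rw [Complex.norm_real, Real.norm_of_nonneg (by positivity)]
  have h1 := hS m (fun k => ((t⁻¹ : ℝ) : ℂ) • A k) fun l B => by
    rw [tensorNorm_flip, tensorNorm_smul_left, hn, inv_mul_le_iff₀ ht0, one_mul]
    exact (E.tensorNorm_le_dualNorms A B).trans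
      (mul_le_mul_of_nonneg_right ht.le (E.norms_nonneg B))
  rw [tensorNorm_smul_left, hn, inv_mul_le_iff₀ ht0, mul_one] at h1
  exact h1

theorem norms_fin_one_le (z : Fin n → ℂ) :
    E.norms 1 (fun k => Matrix.of fun _ _ => z k) ≤ ‖∑ k, z k • E.gen k‖ := by
  rw [norms, tensorNorm_le_iff (norm_nonneg _)]
  intro x
  simp only [Finset.univ_unique, Finset.sum_singleton, Fin.default_eq_zero, Matrix.of_apply]
  rw [← mul_pow]
  gcongr
  simpa using (∑ k, z k • E.gen k).le_opNorm (x 0)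

/-- A completely contractive map is contractive. -/
theorem norm_sum_smul_le {K : Type*} [NormedAddCommGroup K] [InnerProductSpace ℂ K]
    {T : Fin n → (K →L[ℂ] K)} (hT : CompletelyContractive E.norms T) (z : Fin n → ℂ) :
    ‖∑ k, z k • T k‖ ≤ ‖∑ k, z k • E.gen k‖ := by
  have h1 := norm_sum_dotProduct_smul_le (fun k => Matrix.of fun _ _ : Fin 1 => z k) T
    (EuclideanSpace.single 0 1) (EuclideanSpace.single 0 1)
  simp only [Finset.univ_unique, Finset.sum_singleton, Fin.default_eq_zero, Matrix.of_apply,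
    PiLp.single_apply, if_true, one_mul, mul_one, PiLp.norm_single, norm_one]
    at h1
  refine h1.trans ((hT 1 _).trans ?_)
  rw [one_mul]
  exact E.norms_fin_one_le z

end OperatorSpace

/-! ### Gram matrices and isometries -/

/-- Two families of vectors with the same Gram matrix in a finite-dimensional inner product space
differ by an isometry of the space. -/
theorem exists_linearIsometry_of_inner_eq {ι V : Type*} [Fintype ι] [NormedAddCommGroup V]
    [InnerProductSpace ℂ V] [FiniteDimensional ℂ V] {x y : ι → V}
    (h : ∀ i j, ⟪x i, x j⟫_ℂ = ⟪y i, y j⟫_ℂ) : ∃ L : V →ₗᵢ[ℂ] V, ∀ i, L (x i) = y i := by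
  classical
  set Φ := Fintype.linearCombination ℂ x
  set Ψ := Fintype.linearCombination ℂ y
  have hnorm : ∀ c, ‖Φ c‖ = ‖Ψ c‖ := by
    intro c
    have : ⟪Φ c, Φ c⟫_ℂ = ⟪Ψ c, Ψ c⟫_ℂ := by
      simp only [Φ, Ψ, Fintype.linearCombination_apply, sum_inner, inner_sum, inner_smul_left,
        inner_smul_right, h]
    rw [inner_self_eq_norm_sq_to_K, inner_self_eq_norm_sq_to_K] at this
    have h2 : ‖Φ c‖ ^ 2 = ‖Ψ c‖ ^ 2 := by exact_mod_cast this
    exact (sq_eq_sq₀ (norm_nonneg _) (norm_nonneg _)).1 h2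
  -- The isometry is Ψ ∘ Φ⁻¹ on the range of Φ, written with a linear section g of Φ. The choice of
  -- g is immaterial: by `hnorm`, Φ and Ψ have the same kernel.
  obtain ⟨g, hg⟩ := Φ.rangeRestrict.exists_rightInverse_of_surjective Φ.range_rangeRestrict
  have hg' : ∀ s, Φ (g s) = s := fun s => congrArg Subtype.val (LinearMap.congr_fun hg s)
  let L₀ : LinearMap.range Φ →ₗᵢ[ℂ] V :=
    ⟨Ψ ∘ₗ g, fun s => by
      rw [LinearMap.comp_apply, ← hnorm, hg', Submodule.coe_norm]⟩
  refine ⟨L₀.extend, fun i => ?_⟩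
  have hx : Φ (Pi.single i 1) = x i := by
    simp [Φ, Fintype.linearCombination_apply, Pi.single_apply]
  have hy : Ψ (Pi.single i 1) = y i := by
    simp [Ψ, Fintype.linearCombination_apply, Pi.single_apply]
  have h1 := L₀.extend_apply ⟨x i, hx ▸ LinearMap.mem_range_self Φ _⟩
  refine h1.trans (sub_eq_zero.1 (norm_eq_zero.1 ?_))
  change ‖Ψ (g _) - _‖ = 0
  conv_lhs => rw [← hy]
  rw [← map_sub, ← hnorm, map_sub, hg', sub_eq_zero.2 hx.symm, norm_zero]

theorem sum_norm_sq_matrix_smul {ι : Type*} [Fintype ι] (B : Matrix ι ι ℂ) {K : Type*}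
    [NormedAddCommGroup K] [InnerProductSpace ℂ K] (x : ι → K) :
    ((∑ a, ‖∑ b, B a b • x b‖ ^ 2 : ℝ) : ℂ) = ∑ b, ∑ c, (Bᴴ * B) b c * ⟪x b, x c⟫_ℂ := by
  push_cast
  calc ∑ a, ((‖∑ b, B a b • x b‖ : ℝ) : ℂ) ^ 2
      = ∑ a, ⟪∑ b, B a b • x b, ∑ b, B a b • x b⟫_ℂ := by
        simp only [inner_self_eq_norm_sq_to_K]; rfl
    _ = ∑ a, ∑ b, ∑ c, (conj (B a b) * B a c) * ⟪x b, x c⟫_ℂ := by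
        refine Finset.sum_congr rfl fun a _ => ?_
        rw [sum_inner]
        simp only [inner_sum, inner_smul_left, inner_smul_right, mul_assoc]
        exact Finset.sum_congr rfl fun b _ => Finset.sum_congr rfl fun c _ => mul_left_comm _ _ _
    _ = ∑ b, ∑ c, (∑ a, conj (B a b) * B a c) * ⟪x b, x c⟫_ℂ := by
        rw [Finset.sum_comm]
        refine Finset.sum_congr rfl fun b _ => ?_
        rw [Finset.sum_comm]
        simp only [Finset.sum_mul]

/-- An isometric scalar matrix acts isometrically on tuples of vectors. -/
theorem sum_norm_sq_of_conjTranspose_mul_self {ι : Type*} [Fintype ι] [DecidableEq ι]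
    {U : Matrix ι ι ℂ} (hU : Uᴴ * U = 1) {K : Type*} [NormedAddCommGroup K]
    [InnerProductSpace ℂ K] (x : ι → K) :
    ∑ a, ‖∑ b, U a b • x b‖ ^ 2 = ∑ b, ‖x b‖ ^ 2 := by
  have hC : ((∑ a, ‖∑ b, U a b • x b‖ ^ 2 : ℝ) : ℂ) = ((∑ b, ‖x b‖ ^ 2 : ℝ) : ℂ) := by
    rw [sum_norm_sq_matrix_smul, hU]
    push_cast
    simp only [Matrix.one_apply, ite_mul, one_mul, zero_mul, Finset.sum_ite_eq, Finset.mem_univ,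
      if_true, inner_self_eq_norm_sq_to_K]
    rfl
  exact_mod_cast hC

/-! ### Transfer functions at operator tuples -/

section Realization

variable {n m : ℕ} (T : Fin n → Matrix (Fin m) (Fin m) ℂ)
  (U : Matrix (Fin (m + 1)) (Fin (m + 1)) ℂ)

/-- The homogeneous components of the state of the linear system with colligation `U` and pencil
`∑ k, z k • T k`. -/
def statePoly : ℕ → Fin m → MvPolynomial (Fin n) ℂ
  | 0, a => ∑ b, ∑ k, (T k a b * U b.succ 0) • MvPolynomial.X k
  | d + 1, a => ∑ b, ∑ k, T k a b • (MvPolynomial.X k * ∑ c, U b.succ c.succ • statePoly d c)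

/-- The homogeneous components of the transfer function of the linear system with colligation `U`
and pencil `∑ k, z k • T k`. -/
def transferPoly : ℕ → MvPolynomial (Fin n) ℂ
  | 0 => MvPolynomial.C (U 0 0)
  | d + 1 => ∑ a : Fin m, U 0 a.succ • statePoly T U d a

/-- The pencil acts already on the first input, so the state has no constant term and index d
carries degree d + 1. The shift in `transferPoly` undoes this. -/
theorem isHomogeneous_statePoly (d : ℕ) (a : Fin m) :
    (statePoly T U d a).IsHomogeneous (d + 1) := by
  induction d generalizing a with
  | zero =>
    exact MvPolynomial.IsHomogeneous.sum _ _ _ fun b _ => MvPolynomial.IsHomogeneous.sum _ _ _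
      fun k _ => (MvPolynomial.homogeneousSubmodule _ _ _).smul_mem _
        (MvPolynomial.isHomogeneous_X ℂ k)
  | succ d ih =>
    refine MvPolynomial.IsHomogeneous.sum _ _ _ fun b _ => MvPolynomial.IsHomogeneous.sum _ _ _
      fun k _ => (MvPolynomial.homogeneousSubmodule _ _ _).smul_mem _ ?_
    rw [MvPolynomial.mem_homogeneousSubmodule, add_comm (d + 1)]
    exact (MvPolynomial.isHomogeneous_X ℂ k).mul (MvPolynomial.IsHomogeneous.sum _ _ _ fun c _ =>
      (MvPolynomial.homogeneousSubmodule _ _ _).smul_mem _ (ih c))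

theorem isHomogeneous_transferPoly (d : ℕ) : (transferPoly T U d).IsHomogeneous d := by
  cases d with
  | zero => exact MvPolynomial.isHomogeneous_C _ _
  | succ d =>
    exact MvPolynomial.IsHomogeneous.sum _ _ _ fun a _ =>
      (MvPolynomial.homogeneousSubmodule _ _ _).smul_mem _ (isHomogeneous_statePoly T U d a)

section Operators

variable {T U} {K : Type*} [NormedAddCommGroup K] [InnerProductSpace ℂ K]
  {S : Fin n → (K →L[ℂ] K)} {ψ : MvPolynomial (Fin n) ℂ →ₐ[ℂ] (K →L[ℂ] K)}

theorem algHom_statePoly_zero (hψ : ∀ k, ψ (MvPolynomial.X k) = S k) (a : Fin m) (x : K) :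
    ψ (statePoly T U 0 a) x = ∑ b, ∑ k, T k a b • S k (U b.succ 0 • x) := by
  simp [statePoly, hψ, mul_smul]

theorem algHom_statePoly_succ (hψ : ∀ k, ψ (MvPolynomial.X k) = S k) (d : ℕ) (a : Fin m) (x : K) :
    ψ (statePoly T U (d + 1) a) x =
      ∑ b, ∑ k, T k a b • S k (∑ c : Fin m, U b.succ c.succ • ψ (statePoly T U d c) x) := by
  simp [statePoly, hψ]

/-- Energy balance: U ⊗ 1 is isometric on K^(m+1), whose coordinate 0 is the input and output
channel and whose other m coordinates are the state. -/
theorem sum_norm_sq_colligation (hU : Uᴴ * U = 1) (x : K) (y : Fin m → K) :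
    ‖U 0 0 • x + ∑ c : Fin m, U 0 c.succ • y c‖ ^ 2 +
      ∑ b : Fin m, ‖U b.succ 0 • x + ∑ c : Fin m, U b.succ c.succ • y c‖ ^ 2 =
    ‖x‖ ^ 2 + ∑ c, ‖y c‖ ^ 2 := by
  simpa [Fin.sum_univ_succ] using
    sum_norm_sq_of_conjTranspose_mul_self hU (Fin.cons x y : Fin (m + 1) → K)

/-- Each step applies a block of U, which does not increase the energy, and then ∑ T_k ⊗ S_k, which
shrinks the norm by the factor r. -/
theorem sum_norm_sq_statePoly_le (hU : Uᴴ * U = 1) (hψ : ∀ k, ψ (MvPolynomial.X k) = S k) {r : ℝ}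
    (hr : 0 ≤ r) (hTS : tensorNorm T S ≤ r) (d : ℕ) (x : K) :
    ∑ a, ‖ψ (statePoly T U d a) x‖ ^ 2 ≤ (r ^ (d + 1) * ‖x‖) ^ 2 := by
  have hT := (tensorNorm_le_iff hr).1 hTS
  induction d with
  | zero =>
    simp only [algHom_statePoly_zero hψ]
    refine (hT _).trans ?_
    have := sum_norm_sq_colligation hU x 0
    simp only [Pi.zero_apply, smul_zero, Finset.sum_const_zero, add_zero, norm_zero,
      ne_eq, OfNat.ofNat_ne_zero, not_false_eq_true, zero_pow] at this
    rw [zero_add, pow_one, mul_pow]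
    gcongr
    nlinarith [sq_nonneg ‖U 0 0 • x‖]
  | succ d ih =>
    simp only [algHom_statePoly_succ hψ]
    refine (hT _).trans ?_
    have := sum_norm_sq_colligation hU 0 fun c => ψ (statePoly T U d c) x
    simp only [smul_zero, zero_add, norm_zero,
      ne_eq, OfNat.ofNat_ne_zero, not_false_eq_true, zero_pow] at this
    rw [pow_succ' r (d + 1), mul_assoc, mul_pow r]
    gcongr
    nlinarith [sq_nonneg ‖∑ c : Fin m, U 0 c.succ • ψ (statePoly T U d c) x‖]

theorem norm_algHom_transferPoly_succ_le (hU : Uᴴ * U = 1)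
    (hψ : ∀ k, ψ (MvPolynomial.X k) = S k) {r : ℝ} (hr : 0 ≤ r) (hTS : tensorNorm T S ≤ r) (d : ℕ) :
    ‖ψ (transferPoly T U (d + 1))‖ ≤ r ^ (d + 1) := by
  refine ContinuousLinearMap.opNorm_le_bound _ (by positivity) fun x => ?_
  have h1 := sum_norm_sq_colligation hU 0 fun c => ψ (statePoly T U d c) x
  have h2 := sum_norm_sq_statePoly_le hU hψ hr hTS d x
  simp only [smul_zero, zero_add, norm_zero,
    ne_eq, OfNat.ofNat_ne_zero, not_false_eq_true, zero_pow] at h1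
  have h3 : ψ (transferPoly T U (d + 1)) x =
      ∑ c : Fin m, U 0 c.succ • ψ (statePoly T U d c) x := by
    simp [transferPoly]
  rw [h3]
  refine le_of_sq_le_sq (?_ : _ ≤ (r ^ (d + 1) * ‖x‖) ^ 2) (by positivity)
  have : 0 ≤ ∑ b : Fin m, ‖∑ c : Fin m, U b.succ c.succ • ψ (statePoly T U d c) x‖ ^ 2 := by
    positivity
  linarith

/-- The transfer function of an isometric colligation takes contractive values. -/
theorem exists_hasSum_transferPoly [CompleteSpace K] (hU : Uᴴ * U = 1)
    (hψ : ∀ k, ψ (MvPolynomial.X k) = S k) {r : ℝ} (hr : 0 ≤ r) (hr1 : r < 1)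
    (hTS : tensorNorm T S ≤ r) :
    ∃ X : K →L[ℂ] K, HasSum (fun d => ψ (transferPoly T U d)) X ∧ ‖X‖ ≤ 1 := by
  have hsum : Summable fun d => ψ (transferPoly T U d) := by
    rw [← summable_nat_add_iff 1]
    refine Summable.of_norm_bounded (g := fun d => r ^ (d + 1)) ?_ fun d =>
      norm_algHom_transferPoly_succ_le hU hψ hr hTS d
    exact (summable_nat_add_iff 1).2 (summable_geometric_of_lt_one hr hr1)
  refine ⟨_, hsum.hasSum, ContinuousLinearMap.opNorm_le_bound _ zero_le_one fun x => ?_⟩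
  rw [one_mul]
  set X := ∑' d, ψ (transferPoly T U d)
  -- Partial sums of the state satisfy y_(M+1) = (∑ T_k ⊗ S_k)(U₁₀ x + U₁₁ y_M), so the energy
  -- balance applies to them directly. Summing the norms of the homogeneous terms would not give the
  -- bound 1.
  let y : ℕ → Fin m → K := fun M a => ∑ d ∈ Finset.range M, ψ (statePoly T U d a) x
  have hy : ∀ M a, y (M + 1) a =
      ∑ b, ∑ k, T k a b • S k (U b.succ 0 • x + ∑ c : Fin m, U b.succ c.succ • y M c) := by
    intro M a
    induction M with
    | zero => simp [y, algHom_statePoly_zero hψ]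
    | succ M ih =>
      have h1 : ∀ c, y (M + 1) c = y M c + ψ (statePoly T U M c) x := fun c =>
        Finset.sum_range_succ _ _
      have h2 : y (M + 1 + 1) a = y (M + 1) a + ψ (statePoly T U (M + 1) a) x :=
        Finset.sum_range_succ _ _
      rw [h2, ih, algHom_statePoly_succ hψ]
      simp only [h1, map_add, smul_add, Finset.sum_add_distrib, add_assoc]
  have hpart : ∀ M, ∑ d ∈ Finset.range (M + 1), ψ (transferPoly T U d) x =
      U 0 0 • x + ∑ c : Fin m, U 0 c.succ • y M c := by
    intro M
    rw [Finset.sum_range_succ', add_comm]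
    congr 1
    · simp [transferPoly, Algebra.algebraMap_eq_smul_one]
    · simp only [transferPoly, map_sum, map_smul, sum_apply, smul_apply, y, Finset.smul_sum]
      rw [Finset.sum_comm]
  -- The output energy exceeds ‖x‖² by at most the loss of state energy from y_M to y_(M+1). This
  -- loss tends to 0 because the state energies converge.
  have hest : ∀ M, ‖∑ d ∈ Finset.range (M + 1), ψ (transferPoly T U d) x‖ ^ 2 ≤
      ‖x‖ ^ 2 + (∑ c, ‖y M c‖ ^ 2 - ∑ c, ‖y (M + 1) c‖ ^ 2) := by
    intro M
    have h1 := sum_norm_sq_colligation hU x (y M)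
    have h2 := (tensorNorm_le_iff hr).1 hTS fun b =>
      U b.succ 0 • x + ∑ c : Fin m, U b.succ c.succ • y M c
    simp only [← hy] at h2
    rw [hpart]
    have h3 : 0 ≤ ∑ b : Fin m, ‖U b.succ 0 • x + ∑ c : Fin m, U b.succ c.succ • y M c‖ ^ 2 := by
      positivity
    have h4 : r ^ 2 ≤ 1 := pow_le_one₀ hr hr1.le
    linarith [mul_le_of_le_one_left h3 h4]
  have hylim : ∃ z : ℝ, Filter.Tendsto (fun M => ∑ c, ‖y M c‖ ^ 2) Filter.atTop (nhds z) := by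
    have hys : ∀ c, Summable fun d => ψ (statePoly T U d c) x := by
      intro c
      refine Summable.of_norm_bounded (g := fun d => r ^ (d + 1) * ‖x‖) ?_ fun d => ?_
      · exact ((summable_nat_add_iff 1).2 (summable_geometric_of_lt_one hr hr1)).mul_right _
      · refine le_of_sq_le_sq ?_ (by positivity)
        exact (Finset.single_le_sum (f := fun c => ‖ψ (statePoly T U d c) x‖ ^ 2)
          (fun _ _ => sq_nonneg _) (Finset.mem_univ c)).trans
          (sum_norm_sq_statePoly_le hU hψ hr hTS d x)
    exact ⟨_, tendsto_finsetSum _ fun c _ => ((hys c).hasSum.tendsto_sum_nat.norm.pow 2)⟩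
  obtain ⟨z, hz⟩ := hylim
  have hX : Filter.Tendsto (fun M => ∑ d ∈ Finset.range (M + 1), ψ (transferPoly T U d) x)
      Filter.atTop (nhds (X x)) := by
    have := (hsum.hasSum.mapL (ContinuousLinearMap.apply ℂ K x)).tendsto_sum_nat
    exact (Filter.tendsto_add_atTop_iff_nat 1).2 this
  have hlim := le_of_tendsto_of_tendsto' (hX.norm.pow 2)
    (tendsto_const_nhds.add (hz.sub ((Filter.tendsto_add_atTop_iff_nat 1).2 hz))) hest
  rw [sub_self, add_zero] at hlim
  exact le_of_sq_le_sq hlim (norm_nonneg _)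

end Operators

end Realization

/-! ### Transfer functions at points and the lurking isometry -/

section TransferFunction

variable {n m : ℕ} (T : Fin n → Matrix (Fin m) (Fin m) ℂ)
  (U : Matrix (Fin (m + 1)) (Fin (m + 1)) ℂ)

/-- The lower right block of the colligation `U`, as an operator. -/
def stateOp : EuclideanSpace ℂ (Fin m) →L[ℂ] EuclideanSpace ℂ (Fin m) :=
  Matrix.toEuclideanCLM (𝕜 := ℂ) (Matrix.of fun b c : Fin m => U b.succ c.succ)

/-- The lower left block of the colligation `U`, as a vector. -/
def inputVec : EuclideanSpace ℂ (Fin m) := WithLp.toLp 2 fun b : Fin m => U b.succ 0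

/-- The state of the linear system with colligation `U` and pencil `∑ k, z k • T k`. -/
def transferState (z : Fin n → ℂ) : EuclideanSpace ℂ (Fin m) :=
  Ring.inverse (1 - (∑ k, z k • matrixTuple T k) * stateOp U)
    ((∑ k, z k • matrixTuple T k) (inputVec U))

/-- The transfer function of the linear system with colligation `U` and pencil `∑ k, z k • T k`. -/
def transferFun (z : Fin n → ℂ) : ℂ :=
  U 0 0 + ∑ a : Fin m, U 0 a.succ * transferState T U z a

variable {T U}

theorem norm_stateOp_le (hU : Uᴴ * U = 1) : ‖stateOp U‖ ≤ 1 := by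
  refine ContinuousLinearMap.opNorm_le_bound _ zero_le_one fun y => ?_
  have h := sum_norm_sq_colligation hU (0 : ℂ) y.ofLp
  rw [one_mul]
  refine le_of_sq_le_sq ?_ (norm_nonneg _)
  rw [EuclideanSpace.norm_sq_eq, EuclideanSpace.norm_sq_eq]
  simp only [smul_eq_mul, mul_zero, zero_add, norm_zero, ne_eq, OfNat.ofNat_ne_zero,
    not_false_eq_true, zero_pow] at h
  simp only [stateOp, Matrix.ofLp_toEuclideanCLM, Matrix.mulVec, dotProduct, Matrix.of_apply]
  nlinarith [sq_nonneg ‖∑ c : Fin m, U 0 c.succ * y c‖]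

theorem norm_pencil_mul_stateOp_lt_one (hU : Uᴴ * U = 1) {z : Fin n → ℂ}
    (hz : ‖∑ k, z k • matrixTuple T k‖ < 1) :
    ‖(∑ k, z k • matrixTuple T k) * stateOp U‖ < 1 :=
  (norm_mul_le _ _).trans_lt
    ((mul_le_of_le_one_right (norm_nonneg _) (norm_stateOp_le hU)).trans_lt hz)

theorem pencil_apply (z : Fin n → ℂ) (x : EuclideanSpace ℂ (Fin m)) (a : Fin m) :
    (∑ k, z k • matrixTuple T k) x a = ∑ b, ∑ k, T k a b * (z k * x b) := by
  simp only [sum_apply, smul_apply, WithLp.ofLp_sum, Finset.sum_apply, PiLp.smul_apply,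
    matrixTuple_apply, smul_eq_mul, Finset.mul_sum]
  rw [Finset.sum_comm]
  simp only [mul_left_comm]

/-- At a point, the recursion produces the terms of the Neumann series of (1 − T(z)U₁₁)⁻¹ applied to
T(z)U₁₀. -/
theorem eval_statePoly (z : Fin n → ℂ) (d : ℕ) (a : Fin m) :
    MvPolynomial.eval z (statePoly T U d a) =
      ((((∑ k, z k • matrixTuple T k) * stateOp U) ^ d)
        ((∑ k, z k • matrixTuple T k) (inputVec U))) a := by
  induction d generalizing a with
  | zero =>
    rw [pow_zero, one_apply_eq_self, pencil_apply]
    simp only [statePoly, map_sum, MvPolynomial.smul_eval, MvPolynomial.eval_X, inputVec]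
    simp only [mul_assoc, mul_comm (z _)]
  | succ d ih =>
    rw [pow_succ', mul_apply_eq_comp, mul_apply_eq_comp, pencil_apply]
    simp only [statePoly, map_sum, map_mul, MvPolynomial.smul_eval, MvPolynomial.eval_X, ih]
    rfl

theorem hasSum_eval_transferPoly (hU : Uᴴ * U = 1) {z : Fin n → ℂ}
    (hz : ‖∑ k, z k • matrixTuple T k‖ < 1) :
    HasSum (fun d => MvPolynomial.eval z (transferPoly T U d)) (transferFun T U z) := by
  have h := hasSum_geom_series_inverse _ (norm_pencil_mul_stateOp_lt_one hU hz)
  have h2 := h.mapL (ContinuousLinearMap.apply ℂ _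
    ((∑ k, z k • matrixTuple T k) (inputVec U)))
  have h3 : HasSum (fun d => ∑ a : Fin m, U 0 a.succ * MvPolynomial.eval z (statePoly T U d a))
      (∑ a : Fin m, U 0 a.succ * transferState T U z a) := by
    refine hasSum_sum fun a _ => HasSum.mul_left _ ?_
    simp only [eval_statePoly]
    exact h2.mapL (PiLp.proj (𝕜 := ℂ) 2 (fun _ : Fin m => ℂ) a)
  refine (hasSum_nat_add_iff' 1).1 ?_
  simpa [transferPoly, transferFun] using h3

theorem differentiableAt_transferFun (hU : Uᴴ * U = 1) {z : Fin n → ℂ}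
    (hz : ‖∑ k, z k • matrixTuple T k‖ < 1) : DifferentiableAt ℂ (transferFun T U) z := by
  have hu := isUnit_one_sub_of_norm_lt_one (norm_pencil_mul_stateOp_lt_one hU hz)
  have hL : DifferentiableAt ℂ (fun z : Fin n → ℂ => ∑ k, z k • matrixTuple T k) z := by fun_prop
  have hinv : DifferentiableAt ℂ (fun z : Fin n → ℂ =>
      Ring.inverse (1 - (∑ k, z k • matrixTuple T k) * stateOp U)) z :=
    DifferentiableAt.comp (g := Ring.inverse) z (differentiableAt_inverse hu)
      ((differentiableAt_const _).sub (hL.mul (differentiableAt_const _)))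
  have hs : DifferentiableAt ℂ (transferState T U) z :=
    hinv.clm_apply (hL.clm_apply (differentiableAt_const _))
  refine (differentiableAt_const _).add (DifferentiableAt.fun_sum fun a _ =>
    (differentiableAt_const _).mul ?_)
  exact (PiLp.proj 2 (fun _ : Fin m => ℂ) a : _ →L[ℂ] ℂ).differentiableAt.comp z hs

theorem transferState_eq (hU : Uᴴ * U = 1) {z : Fin n → ℂ}
    (hz : ‖∑ k, z k • matrixTuple T k‖ < 1) :
    transferState T U z =
      (∑ k, z k • matrixTuple T k) (inputVec U + stateOp U (transferState T U z)) := by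
  have hu := isUnit_one_sub_of_norm_lt_one (norm_pencil_mul_stateOp_lt_one hU hz)
  have h := congrArg (fun X => X ((∑ k, z k • matrixTuple T k) (inputVec U)))
    (Ring.mul_inverse_cancel _ hu)
  simp only [mul_apply_eq_comp, one_apply_eq_self] at h
  change (1 - (∑ k, z k • matrixTuple T k) * stateOp U) (transferState T U z) = _ at h
  rw [map_add, ← h]
  simp

/-- The interpolation property of the transfer function of a colligation. -/
theorem transferFun_eq_of_vecMul (hU : Uᴴ * U = 1) {z : Fin n → ℂ}
    (hz : ‖∑ k, z k • matrixTuple T k‖ < 1) {w : ℂ} {v : Fin m → ℂ}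
    (h : (Fin.cons 1 (v ᵥ* ∑ k, z k • T k) : Fin (m + 1) → ℂ) ᵥ* U = Fin.cons w v) :
    transferFun T U z = w := by
  set y := transferState T U z with hy
  set q := v ᵥ* ∑ k, z k • T k
  have h0 : U 0 0 + ∑ a : Fin m, q a * U a.succ 0 = w := by
    simpa [Matrix.vecMul, dotProduct, Fin.sum_univ_succ] using congrFun h 0
  have hs : ∀ c : Fin m, U 0 c.succ + ∑ a : Fin m, q a * U a.succ c.succ = v c := fun c => by
    simpa [Matrix.vecMul, dotProduct, Fin.sum_univ_succ] using congrFun h c.succ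
  have hL : (∑ k, z k • matrixTuple T k) = Matrix.toEuclideanCLM (𝕜 := ℂ) (∑ k, z k • T k) := by
    simp [matrixTuple]
  -- Pairing the fixed-point equation y = T(z)(U₁₀ + U₁₁ y) with v produces q = v T(z). The terms q
  -- U₁₁ y cancel against the state columns `hs` of the hypothesis.
  have hvy : v ⬝ᵥ y.ofLp = q ⬝ᵥ (inputVec U).ofLp + q ⬝ᵥ (stateOp U y).ofLp := by
    have := transferState_eq hU hz
    rw [← hy, hL] at this
    rw [this, Matrix.ofLp_toEuclideanCLM, Matrix.dotProduct_mulVec, ← this, WithLp.ofLp_add,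
      dotProduct_add]
  have hq : q ⬝ᵥ (stateOp U y).ofLp = ∑ c : Fin m, (∑ a : Fin m, q a * U a.succ c.succ) * y c := by
    rw [stateOp, Matrix.ofLp_toEuclideanCLM, Matrix.dotProduct_mulVec]
    rfl
  have hin : q ⬝ᵥ (inputVec U).ofLp = ∑ a : Fin m, q a * U a.succ 0 := rfl
  have hv : v ⬝ᵥ y.ofLp = ∑ c : Fin m, U 0 c.succ * y c +
      ∑ c : Fin m, (∑ a : Fin m, q a * U a.succ c.succ) * y c := by
    rw [← Finset.sum_add_distrib]
    exact Finset.sum_congr rfl fun c _ => by rw [← add_mul, hs]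
  rw [transferFun, ← hy, ← h0]
  rw [hvy, hq, hin] at hv
  linear_combination -hv

end TransferFunction

theorem sum_sum_smul_mul_conjTranspose {n m : ℕ} (a b : Fin n → ℂ)
    (T : Fin n → Matrix (Fin m) (Fin m) ℂ) :
    ∑ k, ∑ l, (a k * conj (b l)) • (T k * (T l)ᴴ) = (∑ k, a k • T k) * (∑ l, b l • T l)ᴴ := by
  simp only [Matrix.conjTranspose_sum, Matrix.conjTranspose_smul, Finset.sum_mul,
    Finset.mul_sum, smul_mul_smul_comm]
  exact Finset.sum_comm

/-- The Gram matrix identity of a lurking isometry is solved by an isometric colligation. -/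
theorem exists_colligation {N M : ℕ} {ξ η : Fin N → Fin M → ℂ}
    (h : ∀ i j, ξ i ⬝ᵥ star (ξ j) = η i ⬝ᵥ star (η j)) :
    ∃ U : Matrix (Fin M) (Fin M) ℂ, Uᴴ * U = 1 ∧ ∀ i, ξ i ᵥ* U = η i := by
  obtain ⟨L, hL⟩ := exists_linearIsometry_of_inner_eq (V := EuclideanSpace ℂ (Fin M))
    -- Row vectors act from the left, so L is built on their conjugates and U is the adjoint of its
    -- matrix. That adjoint is isometric as well, since an isometry of a finite-dimensional space is
    -- unitary.
    (x := fun i => WithLp.toLp 2 (star (ξ i))) (y := fun i => WithLp.toLp 2 (star (η i)))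
    fun i j => by
      simpa [EuclideanSpace.inner_eq_star_dotProduct, dotProduct_comm] using h i j
  set A := (Matrix.toEuclideanCLM (n := Fin M) (𝕜 := ℂ)).symm L.toContinuousLinearMap with hA
  have hAL : Matrix.toEuclideanCLM (n := Fin M) (𝕜 := ℂ) A = L.toContinuousLinearMap := by
    simp [hA]
  have h1 : Aᴴ * A = 1 := by
    apply EquivLike.injective (Matrix.toEuclideanCLM (n := Fin M) (𝕜 := ℂ))
    rw [map_mul, ← Matrix.star_eq_conjTranspose, map_star, hAL, map_one]
    exact (ContinuousLinearMap.isometry_iff_adjoint_comp_self _).1 L.isometry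
  refine ⟨Aᴴ, by rw [Matrix.conjTranspose_conjTranspose]; exact mul_eq_one_comm.1 h1, fun i => ?_⟩
  have h2 : A *ᵥ star (ξ i) = star (η i) := by
    have := hL i
    change L.toContinuousLinearMap _ = _ at this
    rw [← hAL, Matrix.toEuclideanCLM_toLp] at this
    exact (WithLp.toLp_injective 2) this
  have := congrArg star h2
  rwa [Matrix.star_mulVec, star_star, star_star] at this

/-! ### Sufficiency of the kernel identity -/

namespace OperatorSpace

universe u

variable {n m N : ℕ} {H : Type u} [NormedAddCommGroup H] [InnerProductSpace ℂ H]
  (E : OperatorSpace n H)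

/-- Complete contractivity for E puts T in the unit ball of M_m(E*), so the strict bound r for σ_S
on E* applies to T itself. -/
theorem tensorNorm_lt_of_isTestTuple {T : Fin n → Matrix (Fin m) (Fin m) ℂ}
    (hT : CompletelyContractive E.norms (matrixTuple T)) {K : Type} [NormedAddCommGroup K]
    [InnerProductSpace ℂ K] {S : Fin n → (K →L[ℂ] K)} (hS : E.IsTestTuple S) :
    ∃ r : ℝ, 0 ≤ r ∧ r < 1 ∧ tensorNorm T S ≤ r := by
  obtain ⟨-, r, hr, hr1, h⟩ := hS
  exact ⟨r, hr, hr1, (h m T).trans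
    (mul_le_of_le_one_right hr (E.dualNorms_le_one_of_completelyContractive hT))⟩

/-- The transfer function of a completely contractive pencil and an isometric colligation is in the
unit ball of `UC^∞(E)`. -/
theorem transferFun_mem_unitBall {T : Fin n → Matrix (Fin m) (Fin m) ℂ}
    (hT : CompletelyContractive E.norms (matrixTuple T))
    {U : Matrix (Fin (m + 1)) (Fin (m + 1)) ℂ} (hU : Uᴴ * U = 1) :
    transferFun T U ∈ E.UCInfty ∧ E.ucNorm (transferFun T U) ≤ 1 := by
  have hball : ∀ z ∈ E.ball, ‖∑ k, z k • matrixTuple T k‖ < 1 := fun z hz =>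
    (E.norm_sum_smul_le hT z).trans_lt hz
  have hval : ∀ (K : Type) [NormedAddCommGroup K] [InnerProductSpace ℂ K] [CompleteSpace K]
      (S : Fin n → (K →L[ℂ] K)), E.IsTestTuple S →
        ∃ X : K →L[ℂ] K, HasValueAt E.ball (transferFun T U) S X ∧ ‖X‖ ≤ 1 := by
    intro K _ _ _ S hS
    obtain ⟨r, hr, hr1, hTS⟩ := E.tensorNorm_lt_of_isTestTuple hT hS
    obtain ⟨ψ, hψ⟩ := exists_algHom_of_commute hS.1
    obtain ⟨X, hX, hX1⟩ := exists_hasSum_transferPoly hU hψ hr hr1 hTS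
    refine ⟨X, ⟨transferPoly T U, ⟨isHomogeneous_transferPoly T U, fun z hz =>
      hasSum_eval_transferPoly hU (hball z hz)⟩, ?_⟩, hX1⟩
    simpa only [polyEval_eq_algHom ψ hψ] using hX
  refine ⟨⟨fun z hz => (differentiableAt_transferFun hU (hball z hz)).differentiableWithinAt,
    1, hval⟩, Real.sSup_le ?_ zero_le_one⟩
  rintro _ ⟨K, _, _, _, S, X, hS, hX, rfl⟩
  obtain ⟨Y, hY, hY1⟩ := hval K S hS
  rwa [E.hasValueAt_unique hX hY]

theorem exists_mem_unitBall_of_kernel {lam : Fin N → Fin n → ℂ} (hlam : ∀ j, lam j ∈ E.ball)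
    {w : Fin N → ℂ} {T : Fin n → Matrix (Fin m) (Fin m) ℂ} {v : Fin N → Fin m → ℂ}
    (hT : CompletelyContractive E.norms (matrixTuple T))
    (h : ∀ i j, 1 - w i * conj (w j) =
      v i ⬝ᵥ ((1 - ∑ k, ∑ l, (lam i k * conj (lam j l)) • (T k * (T l)ᴴ)) *ᵥ star (v j))) :
    ∃ f ∈ E.UCInfty, E.ucNorm f ≤ 1 ∧ ∀ j, f (lam j) = w j := by
  obtain ⟨U, hU, hUv⟩ := exists_colligation (M := m + 1)
    (ξ := fun i => Fin.cons 1 (v i ᵥ* ∑ k, lam i k • T k)) (η := fun i => Fin.cons (w i) (v i))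
    fun i j => by
      have := h i j
      rw [sum_sum_smul_mul_conjTranspose, Matrix.sub_mulVec, Matrix.one_mulVec, dotProduct_sub, ← Matrix.mulVec_mulVec,
        Matrix.dotProduct_mulVec, ← Matrix.star_vecMul] at this
      have h1 : ∀ (a b : ℂ) (x y : Fin m → ℂ), (Fin.cons a x : Fin (m + 1) → ℂ) ⬝ᵥ
          star (Fin.cons b y : Fin (m + 1) → ℂ) = a * conj b + x ⬝ᵥ star y := fun a b x y => by
        simp [dotProduct, Fin.sum_univ_succ]
      rw [h1, h1, map_one, mul_one]
      linear_combination this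
  obtain ⟨hmem, hnorm⟩ := E.transferFun_mem_unitBall hT hU
  exact ⟨_, hmem, hnorm, fun j => transferFun_eq_of_vecMul hU
    ((E.norm_sum_smul_le hT _).trans_lt (hlam j)) (hUv j)⟩

end OperatorSpace

/-! ### Direct sums, Pick kernels and compressions -/

section DirectSum

variable {n : ℕ} {K : Type*} [NormedAddCommGroup K] [InnerProductSpace ℂ K]

/-- The direct sum of tuples of operators. -/
def directSum {q : ℕ} (T : Fin q → Fin n → (K →L[ℂ] K)) (k : Fin n) :
    PiLp 2 (fun _ : Fin q => K) →L[ℂ] PiLp 2 (fun _ : Fin q => K) :=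
  blockOp fun a b => if a = b then T a k else 0

theorem directSum_apply {q : ℕ} (T : Fin q → Fin n → (K →L[ℂ] K)) (k : Fin n)
    (x : PiLp 2 (fun _ : Fin q => K)) (a : Fin q) : directSum T k x a = T a k (x a) := by
  rw [directSum, blockOp_apply, Finset.sum_eq_single a] <;> simp +contextual [eq_comm]

theorem tensorNorm_directSum_le {q m : ℕ} (T : Fin q → Fin n → (K →L[ℂ] K))
    (A : Fin n → Matrix (Fin m) (Fin m) ℂ) {C : ℝ} (hC : 0 ≤ C)
    (h : ∀ a, tensorNorm A (T a) ≤ C) : tensorNorm A (directSum T) ≤ C := by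
  rw [tensorNorm_le_iff hC]
  intro x
  simp only [PiLp.norm_sq_eq_of_L2, WithLp.ofLp_sum, Finset.sum_apply, PiLp.smul_apply,
    directSum_apply]
  rw [Finset.sum_comm, Finset.sum_comm (f := fun b i => ‖x b i‖ ^ 2), Finset.mul_sum]
  exact Finset.sum_le_sum fun a _ => (tensorNorm_le_iff hC).1 (h a) fun b => x b a

end DirectSum

section PickKernel

variable {n N : ℕ} {K : Type*} [NormedAddCommGroup K] [InnerProductSpace ℂ K] [CompleteSpace K]

/-- The matrix `u_i* [1 - T(λ_i) T(λ_j)*] u_j`, where `T(z) = ∑ k, z k • T k`. -/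
def pickKernel (lam : Fin N → Fin n → ℂ) (T : Fin n → (K →L[ℂ] K)) (u : Fin N → K)
    (i j : Fin N) : ℂ :=
  ⟪u i, u j⟫_ℂ - ⟪ContinuousLinearMap.adjoint (∑ k, lam i k • T k) (u i),
    ContinuousLinearMap.adjoint (∑ k, lam j k • T k) (u j)⟫_ℂ

theorem conj_pickKernel (lam : Fin N → Fin n → ℂ) (T : Fin n → (K →L[ℂ] K)) (u : Fin N → K)
    (i j : Fin N) : conj (pickKernel lam T u i j) = pickKernel lam T u j i := by
  simp only [pickKernel, map_sub, inner_conj_symm]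

theorem re_pickKernel_self (lam : Fin N → Fin n → ℂ) (T : Fin n → (K →L[ℂ] K)) (u : Fin N → K)
    (i : Fin N) : (pickKernel lam T u i i).re =
      ‖u i‖ ^ 2 - ‖ContinuousLinearMap.adjoint (∑ k, lam i k • T k) (u i)‖ ^ 2 := by
  rw [pickKernel, Complex.sub_re]
  exact congrArg₂ _ (inner_self_eq_norm_sq (𝕜 := ℂ) _) (inner_self_eq_norm_sq (𝕜 := ℂ) _)

theorem pickKernel_smul (lam : Fin N → Fin n → ℂ) (T : Fin n → (K →L[ℂ] K)) (u : Fin N → K)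
    (c : ℂ) : pickKernel lam T (fun i => c • u i) = (conj c * c) • pickKernel lam T u := by
  funext i j
  simp only [pickKernel, map_smul, inner_smul_left, inner_smul_right, Pi.smul_apply, smul_eq_mul]
  ring

/-- Compression of a Pick kernel to a space that contains all relevant vectors. -/
theorem pickKernel_compress {K' : Type*} [NormedAddCommGroup K'] [InnerProductSpace ℂ K']
    [CompleteSpace K'] (lam : Fin N → Fin n → ℂ) (T : Fin n → (K →L[ℂ] K)) (u : Fin N → K)
    (W : K →L[ℂ] K')
    (hu : ∀ i, ContinuousLinearMap.adjoint W (W (u i)) = u i)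
    (hTu : ∀ i, ContinuousLinearMap.adjoint W
      (W (ContinuousLinearMap.adjoint (∑ k, lam i k • T k) (u i))) =
        ContinuousLinearMap.adjoint (∑ k, lam i k • T k) (u i)) :
    pickKernel lam (fun k => W ∘L T k ∘L ContinuousLinearMap.adjoint W) (fun i => W (u i)) =
      pickKernel lam T u := by
  have hadj : ∀ i, ContinuousLinearMap.adjoint
      (∑ k, lam i k • (W ∘L T k ∘L ContinuousLinearMap.adjoint W)) (W (u i)) =
        W (ContinuousLinearMap.adjoint (∑ k, lam i k • T k) (u i)) := by
    intro i
    have : ∑ k, lam i k • (W ∘L T k ∘L ContinuousLinearMap.adjoint W) =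
        W ∘L (∑ k, lam i k • T k) ∘L ContinuousLinearMap.adjoint W := by
      ext x
      simp [map_sum]
    rw [this, ContinuousLinearMap.adjoint_comp, ContinuousLinearMap.adjoint_comp,
      ContinuousLinearMap.adjoint_adjoint]
    simp only [ContinuousLinearMap.comp_apply]
    rw [hu]
  funext i j
  simp only [pickKernel, hadj]
  rw [← ContinuousLinearMap.adjoint_inner_left, ← ContinuousLinearMap.adjoint_inner_left, hu, hTu]

theorem adjoint_directSum_apply {q : ℕ} (T : Fin q → Fin n → (K →L[ℂ] K)) (z : Fin n → ℂ)
    (x : PiLp 2 (fun _ : Fin q => K)) :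
    ContinuousLinearMap.adjoint (∑ k, z k • directSum T k) x =
      WithLp.toLp 2 fun a => ContinuousLinearMap.adjoint (∑ k, z k • T a k) (x a) := by
  refine ext_inner_left ℂ fun y => ?_
  rw [ContinuousLinearMap.adjoint_inner_right, PiLp.inner_apply, PiLp.inner_apply]
  refine Finset.sum_congr rfl fun a _ => ?_
  rw [ContinuousLinearMap.adjoint_inner_right]
  simp [directSum_apply]

theorem pickKernel_directSum {q : ℕ} (lam : Fin N → Fin n → ℂ)
    (T : Fin q → Fin n → (K →L[ℂ] K)) (u : Fin q → Fin N → K) :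
    pickKernel lam (directSum T) (fun i => WithLp.toLp 2 fun a => u a i) =
      ∑ a, pickKernel lam (T a) (u a) := by
  funext i j
  simp only [pickKernel, adjoint_directSum_apply, PiLp.inner_apply, Finset.sum_apply,
    Finset.sum_sub_distrib]

theorem continuous_pickKernel (lam : Fin N → Fin n → ℂ) :
    Continuous fun p : (Fin n → (K →L[ℂ] K)) × (Fin N → K) => pickKernel lam p.1 p.2 := by
  have hadj : ∀ i, Continuous fun p : (Fin n → (K →L[ℂ] K)) × (Fin N → K) =>
      ContinuousLinearMap.adjoint (∑ k, lam i k • p.1 k) (p.2 i) := fun i =>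
    (ContinuousLinearMap.adjoint.continuous.comp (by fun_prop)).clm_apply (by fun_prop)
  refine continuous_pi fun i => continuous_pi fun j => ?_
  exact (Continuous.inner (by fun_prop) (by fun_prop)).sub ((hadj i).inner (hadj j))

end PickKernel

/-- A finite-dimensional inner product space embeds isometrically in a Euclidean space of larger
dimension. -/
theorem exists_linearIsometry_euclideanSpace {R : Type*} [NormedAddCommGroup R]
    [InnerProductSpace ℂ R] [FiniteDimensional ℂ R] {M : ℕ} (h : Module.finrank ℂ R ≤ M) :
    Nonempty (R →ₗᵢ[ℂ] EuclideanSpace ℂ (Fin M)) := by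
  let b := stdOrthonormalBasis ℂ R
  let f := b.toBasis.constr ℂ fun i => EuclideanSpace.basisFun (Fin M) ℂ (Fin.castLE h i)
  refine ⟨f.isometryOfOrthonormal (v := b.toBasis) (by simp) ?_⟩
  have : f ∘ b.toBasis = EuclideanSpace.basisFun (Fin M) ℂ ∘ Fin.castLE h := by
    funext i
    simp [f]
  rw [this]
  exact (EuclideanSpace.basisFun (Fin M) ℂ).orthonormal.comp _ (Fin.castLE_injective h)

/-- A contraction to a Euclidean space that is isometric on the span of finitely many given
vectors. -/
theorem exists_contraction_euclideanSpace {K : Type*} [NormedAddCommGroup K]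
    [InnerProductSpace ℂ K] [CompleteSpace K] {ι : Type*} [Fintype ι] {M : ℕ}
    (hM : Fintype.card ι ≤ M) (u : ι → K) :
    ∃ W : K →L[ℂ] EuclideanSpace ℂ (Fin M), ‖W‖ ≤ 1 ∧
      ∀ i, ContinuousLinearMap.adjoint W (W (u i)) = u i := by
  let R := Submodule.span ℂ (Set.range u)
  have : FiniteDimensional ℂ R := FiniteDimensional.span_of_finite ℂ (Set.finite_range u)
  obtain ⟨J⟩ := exists_linearIsometry_euclideanSpace (R := R) ((finrank_range_le_card u).trans hM)
  -- W is the orthogonal projection onto the span followed by an isometric embedding, so W*W is that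
  -- projection.
  refine ⟨J.toContinuousLinearMap ∘L R.orthogonalProjectionOnto, ?_, fun i => ?_⟩
  · refine (ContinuousLinearMap.opNorm_comp_le _ _).trans ?_
    exact mul_le_one₀ J.norm_toContinuousLinearMap_le (norm_nonneg _)
      R.orthogonalProjectionOnto_norm_le
  · refine ext_inner_left ℂ fun y => ?_
    rw [ContinuousLinearMap.adjoint_inner_right]
    simp only [ContinuousLinearMap.comp_apply, LinearIsometry.coe_toContinuousLinearMap,
      LinearIsometry.inner_map_map]
    have hi : u i ∈ R := Submodule.subset_span ⟨i, rfl⟩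
    have hp := R.orthogonalProjectionOnto_mem_subspace_eq_self ⟨u i, hi⟩
    exact (congrArg (fun z => ⟪R.orthogonalProjectionOnto y, z⟫_ℂ) hp).trans
      (R.inner_orthogonalProjectionOnto_eq_of_mem_right ⟨u i, hi⟩ y)

/-! ### The closed convex cone of Pick kernels -/

namespace OperatorSpace

universe u

variable {n N : ℕ} {H : Type u} [NormedAddCommGroup H] [InnerProductSpace ℂ H]
  (E : OperatorSpace n H)

/-- The cone of the Pick kernels of completely contractive tuples, on a space of a fixed dimension
that is large enough to realize all of them. -/
def pickCone (lam : Fin N → Fin n → ℂ) : Set (Fin N → Fin N → ℂ) :=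
  {X | ∃ (T : Fin n → (EuclideanSpace ℂ (Fin (N + N)) →L[ℂ] EuclideanSpace ℂ (Fin (N + N))))
    (u : Fin N → EuclideanSpace ℂ (Fin (N + N))),
      CompletelyContractive E.norms T ∧ pickKernel lam T u = X}

/-- The kernel involves only the 2N vectors u_i and T(λ_i)* u_i. Compressing to their span preserves
it as well as complete contractivity, which explains the dimension N + N. -/
theorem pickKernel_mem_pickCone {K : Type*} [NormedAddCommGroup K] [InnerProductSpace ℂ K]
    [CompleteSpace K] (lam : Fin N → Fin n → ℂ) {T : Fin n → (K →L[ℂ] K)}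
    (hT : CompletelyContractive E.norms T) (u : Fin N → K) :
    pickKernel lam T u ∈ E.pickCone lam := by
  obtain ⟨W, hW, hWu⟩ := exists_contraction_euclideanSpace (ι := Fin N ⊕ Fin N) (M := N + N)
    (by simp) (Sum.elim u fun i => ContinuousLinearMap.adjoint (∑ k, lam i k • T k) (u i))
  refine ⟨_, _, fun m A => ?_, pickKernel_compress lam T u W (fun i => hWu (Sum.inl i))
    fun i => hWu (Sum.inr i)⟩
  exact (tensorNorm_compress_le A T W _ hW (by rwa [LinearIsometryEquiv.norm_map])).trans (hT m A)

/-- Kernels of direct sums add up, and scaling u by √s scales the kernel by s. The direct sum has a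
larger dimension, which compression reduces again. -/
theorem convex_pickCone (lam : Fin N → Fin n → ℂ) : Convex ℝ (E.pickCone lam) := by
  rintro _ ⟨T₁, u₁, hT₁, rfl⟩ _ ⟨T₂, u₂, hT₂, rfl⟩ s t hs ht -
  have h : s • pickKernel lam T₁ u₁ + t • pickKernel lam T₂ u₂ =
      pickKernel lam (directSum ![T₁, T₂]) (fun i => WithLp.toLp 2 fun a =>
        (![fun i => ((√s : ℝ) : ℂ) • u₁ i, fun i => ((√t : ℝ) : ℂ) • u₂ i] : Fin 2 → _) a i) := by
    have hsq : ∀ r : ℝ, 0 ≤ r → conj ((√r : ℝ) : ℂ) * ((√r : ℝ) : ℂ) = r := fun r hr => by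
      rw [Complex.conj_ofReal, ← Complex.ofReal_mul, Real.mul_self_sqrt hr]
    rw [pickKernel_directSum, Fin.sum_univ_two]
    simp only [Matrix.cons_val_zero, Matrix.cons_val_one, pickKernel_smul, hsq _ hs, hsq _ ht]
    rfl
  rw [h]
  refine E.pickKernel_mem_pickCone lam (fun m A => ?_) _
  refine tensorNorm_directSum_le _ A (by simpa using E.norms_nonneg A) fun a => ?_
  fin_cases a
  · exact hT₁ m A
  · exact hT₂ m A

theorem smul_mem_pickCone (lam : Fin N → Fin n → ℂ) {X : Fin N → Fin N → ℂ}
    (hX : X ∈ E.pickCone lam) (t : ℝ) : ((t : ℂ) * t) • X ∈ E.pickCone lam := by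
  obtain ⟨T, u, hT, rfl⟩ := hX
  exact ⟨T, fun i => (t : ℂ) • u i, hT, by rw [pickKernel_smul, Complex.conj_ofReal]⟩

theorem isClosed_completelyContractive (K : Type*) [NormedAddCommGroup K]
    [InnerProductSpace ℂ K] :
    IsClosed {T : Fin n → (K →L[ℂ] K) | CompletelyContractive E.norms T} := by
  have : {T : Fin n → (K →L[ℂ] K) | CompletelyContractive E.norms T} =
      ⋂ (m : ℕ) (A : Fin n → Matrix (Fin m) (Fin m) ℂ) (x : Fin m → K),
        {T | ∑ a, ‖∑ b, ∑ k, A k a b • T k (x b)‖ ^ 2 ≤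
          (1 * E.norms m A) ^ 2 * ∑ b, ‖x b‖ ^ 2} := by
    ext T
    simp only [Set.mem_iInter, Set.mem_ofPred_eq]
    exact forall_congr' fun m => forall_congr' fun A =>
      tensorNorm_le_iff (by simpa using E.norms_nonneg A)
  rw [this]
  refine isClosed_iInter fun m => isClosed_iInter fun A => isClosed_iInter fun x =>
    isClosed_le ?_ continuous_const
  have h : ∀ k (y : K), Continuous fun T : Fin n → (K →L[ℂ] K) => T k y := fun k y =>
    (ContinuousLinearMap.apply ℂ K y).continuous.comp (continuous_apply k)
  fun_prop

theorem norm_le_of_completelyContractive {K : Type*} [NormedAddCommGroup K]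
    [InnerProductSpace ℂ K] {T : Fin n → (K →L[ℂ] K)} (hT : CompletelyContractive E.norms T)
    (k : Fin n) : ‖T k‖ ≤ ‖E.gen k‖ := by
  have := E.norm_sum_smul_le hT (Pi.single k 1)
  simpa [Pi.single_apply, ite_smul] using this

/-- For λ_i in the open ball the factor on the left is positive, so the diagonal of a kernel
controls the vectors u_i. This gives the compactness behind closedness of the cone. -/
theorem mul_norm_sq_le_re_pickKernel {K : Type*} [NormedAddCommGroup K]
    [InnerProductSpace ℂ K] [CompleteSpace K] {T : Fin n → (K →L[ℂ] K)}
    (hT : CompletelyContractive E.norms T) (lam : Fin N → Fin n → ℂ) (u : Fin N → K) (i : Fin N) :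
    (1 - ‖∑ k, lam i k • E.gen k‖ ^ 2) * ‖u i‖ ^ 2 ≤ (pickKernel lam T u i i).re := by
  have h : ‖ContinuousLinearMap.adjoint (∑ k, lam i k • T k) (u i)‖ ^ 2 ≤
      ‖∑ k, lam i k • E.gen k‖ ^ 2 * ‖u i‖ ^ 2 := by
    rw [← mul_pow]
    gcongr
    refine ContinuousLinearMap.le_of_opNorm_le _ ?_ _
    rw [LinearIsometryEquiv.norm_map]
    exact E.norm_sum_smul_le hT (lam i)
  rw [re_pickKernel_self]
  linarith

/-- In a convergent sequence of kernels the T are bounded by complete contractivity and the u by the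
diagonal entries. As V is finite-dimensional, a subsequence of the pairs converges, and complete
contractivity survives the limit. -/
theorem isClosed_pickKernel_image {lam : Fin N → Fin n → ℂ} (hlam : ∀ j, lam j ∈ E.ball)
    (V : Type*) [NormedAddCommGroup V] [InnerProductSpace ℂ V] [CompleteSpace V]
    [FiniteDimensional ℂ V] :
    IsClosed {X | ∃ (T : Fin n → (V →L[ℂ] V)) (u : Fin N → V),
      CompletelyContractive E.norms T ∧ pickKernel lam T u = X} := by
  refine IsSeqClosed.isClosed fun X Y hX hXY => ?_
  choose T u hT hTX using hX
  obtain ⟨C, hC⟩ := (Metric.isBounded_range_of_tendsto X hXY).exists_norm_le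
  have hu : ∀ q i, ‖u q i‖ ^ 2 ≤ C / (1 - ‖∑ k, lam i k • E.gen k‖ ^ 2) := by
    intro q i
    have hlt : ‖∑ k, lam i k • E.gen k‖ < 1 := hlam i
    have h1 : 0 < 1 - ‖∑ k, lam i k • E.gen k‖ ^ 2 := by
      nlinarith [norm_nonneg (∑ k, lam i k • E.gen k)]
    rw [le_div_iff₀ h1, mul_comm]
    refine (E.mul_norm_sq_le_re_pickKernel (hT q) lam (u q) i).trans ?_
    rw [hTX]
    exact (Complex.re_le_norm _).trans
      ((norm_le_pi_norm _ i).trans ((norm_le_pi_norm _ i).trans (hC _ ⟨q, rfl⟩)))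
  have hbdd : Bornology.IsBounded (Set.range fun q => (T q, u q)) := by
    rw [isBounded_iff_forall_norm_le]
    refine ⟨max (∑ k, ‖E.gen k‖) (∑ i, √(C / (1 - ‖∑ k, lam i k • E.gen k‖ ^ 2))), ?_⟩
    rintro _ ⟨q, rfl⟩
    rw [Prod.norm_mk]
    refine max_le_max ((pi_norm_le_iff_of_nonneg (by positivity)).2 fun k => ?_)
      ((pi_norm_le_iff_of_nonneg (by positivity)).2 fun i => ?_)
    · exact (E.norm_le_of_completelyContractive (hT q) k).trans
        (Finset.single_le_sum (f := fun k => ‖E.gen k‖) (fun _ _ => norm_nonneg _)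
          (Finset.mem_univ k))
    · exact (Real.le_sqrt_of_sq_le (hu q i)).trans
        (Finset.single_le_sum (f := fun i => √(C / (1 - ‖∑ k, lam i k • E.gen k‖ ^ 2)))
          (fun _ _ => Real.sqrt_nonneg _) (Finset.mem_univ i))
  have hproper : ProperSpace ((Fin n → (V →L[ℂ] V)) × (Fin N → V)) :=
    FiniteDimensional.proper ℂ _
  obtain ⟨⟨T₀, u₀⟩, -, φ, hφ, hlim⟩ := tendsto_subseq_of_bounded hbdd fun q => Set.mem_range_self q
  have hT₀ : CompletelyContractive E.norms T₀ :=
    (E.isClosed_completelyContractive _).mem_of_tendsto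
      ((continuous_fst.tendsto _).comp hlim) (Filter.Eventually.of_forall fun q => hT (φ q))
  refine ⟨T₀, u₀, hT₀, ?_⟩
  have hcont := continuous_pickKernel (K := V) lam
  refine tendsto_nhds_unique ((hcont.tendsto _).comp hlim) ?_
  have := hXY.comp hφ.tendsto_atTop
  simpa only [Function.comp_def, hTX] using this

theorem isClosed_pickCone {lam : Fin N → Fin n → ℂ} (hlam : ∀ j, lam j ∈ E.ball) :
    IsClosed (E.pickCone lam) :=
  E.isClosed_pickKernel_image hlam _

end OperatorSpace

/-! ### Adjoints and simultaneously diagonalized tuples -/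

section Adjoint

variable {n m : ℕ} {K : Type*} [NormedAddCommGroup K] [InnerProductSpace ℂ K] [CompleteSpace K]

theorem adjoint_blockOp (M : Fin m → Fin m → (K →L[ℂ] K)) :
    ContinuousLinearMap.adjoint (blockOp M) =
      blockOp fun a b => ContinuousLinearMap.adjoint (M b a) := by
  refine (ContinuousLinearMap.eq_adjoint_iff _ _).2 (fun x y => ?_) |>.symm
  simp only [PiLp.inner_apply, blockOp_apply, sum_inner, inner_sum,
    ContinuousLinearMap.adjoint_inner_left]
  exact Finset.sum_comm

theorem tensorNorm_conjTranspose (A : Fin n → Matrix (Fin m) (Fin m) ℂ) (S : Fin n → (K →L[ℂ] K)) :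
    tensorNorm (fun k => (A k)ᴴ) (fun k => ContinuousLinearMap.adjoint (S k)) =
      tensorNorm A S := by
  have h : (blockOp fun a b => ∑ k, (A k)ᴴ a b • ContinuousLinearMap.adjoint (S k)) =
      ContinuousLinearMap.adjoint (blockOp fun a b => ∑ k, A k a b • S k) := by
    rw [adjoint_blockOp]
    congr 1
    funext a b
    simp only [map_sum, map_smulₛₗ]
    rfl
  rw [tensorNorm, h]
  exact LinearIsometryEquiv.norm_map ContinuousLinearMap.adjoint _

end Adjoint

/-- The diagonal matrix `diag c`, conjugated by the invertible matrix `P`. -/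
def conjDiagonal {N : ℕ} (P : Matrix (Fin N) (Fin N) ℂ) (c : Fin N → ℂ) :
    Matrix (Fin N) (Fin N) ℂ :=
  P * Matrix.diagonal c * P⁻¹

section ConjDiagonal

variable {n N : ℕ} {P : Matrix (Fin N) (Fin N) ℂ}

theorem conjDiagonal_mul (hP : IsUnit P.det) (c d : Fin N → ℂ) :
    conjDiagonal P c * conjDiagonal P d = conjDiagonal P (c * d) := by
  have : P⁻¹ * P = 1 := Matrix.nonsing_inv_mul P hP
  calc P * Matrix.diagonal c * P⁻¹ * (P * Matrix.diagonal d * P⁻¹)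
      = P * Matrix.diagonal c * (P⁻¹ * P) * Matrix.diagonal d * P⁻¹ := by
        simp only [Matrix.mul_assoc]
    _ = P * (Matrix.diagonal c * Matrix.diagonal d) * P⁻¹ := by
        rw [this, Matrix.mul_one, Matrix.mul_assoc P]
    _ = _ := by rw [Matrix.diagonal_mul_diagonal]; rfl

theorem conjDiagonal_add (c d : Fin N → ℂ) :
    conjDiagonal P (c + d) = conjDiagonal P c + conjDiagonal P d := by
  change P * Matrix.diagonal (fun i => c i + d i) * P⁻¹ = _
  rw [← Matrix.diagonal_add, Matrix.mul_add, Matrix.add_mul]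
  rfl

theorem conjDiagonal_smul (a : ℂ) (c : Fin N → ℂ) :
    conjDiagonal P (a • c) = a • conjDiagonal P c := by
  rw [conjDiagonal, Matrix.diagonal_smul, Matrix.mul_smul, Matrix.smul_mul]
  rfl

theorem conjDiagonal_one (hP : IsUnit P.det) : conjDiagonal P 1 = 1 := by
  change P * Matrix.diagonal (fun _ => 1) * P⁻¹ = 1
  rw [Matrix.diagonal_one, Matrix.mul_one, Matrix.mul_nonsing_inv P hP]

/-- `conjDiagonal`, valued in the operators on Euclidean space. -/
def conjDiagonalOp (P : Matrix (Fin N) (Fin N) ℂ) :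
    (Fin N → ℂ) →ₗ[ℂ] (EuclideanSpace ℂ (Fin N) →L[ℂ] EuclideanSpace ℂ (Fin N)) where
  toFun c := Matrix.toEuclideanCLM (𝕜 := ℂ) (conjDiagonal P c)
  map_add' c d := by rw [conjDiagonal_add, map_add]
  map_smul' a c := by rw [conjDiagonal_smul, map_smul]; rfl

/-- A polynomial in a tuple of simultaneously diagonalized operators. -/
theorem polyEval_conjDiagonalOp (hP : IsUnit P.det) (mu : Fin N → Fin n → ℂ)
    (p : MvPolynomial (Fin n) ℂ) :
    polyEval p (fun k => conjDiagonalOp P fun i => mu i k) =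
      conjDiagonalOp P fun i => MvPolynomial.eval (mu i) p := by
  let ψ : MvPolynomial (Fin n) ℂ →ₐ[ℂ]
      (EuclideanSpace ℂ (Fin N) →L[ℂ] EuclideanSpace ℂ (Fin N)) :=
    AlgHom.ofLinearMap ((conjDiagonalOp P).comp
        (LinearMap.pi fun i => (MvPolynomial.aeval (mu i)).toLinearMap))
      (by
        change Matrix.toEuclideanCLM (𝕜 := ℂ) (conjDiagonal P _) = 1
        rw [← map_one (Matrix.toEuclideanCLM (n := Fin N) (𝕜 := ℂ)), ← conjDiagonal_one hP]
        congr 2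
        funext i
        simp)
      (fun p q => by
        change Matrix.toEuclideanCLM (𝕜 := ℂ) (conjDiagonal P _) =
          Matrix.toEuclideanCLM (𝕜 := ℂ) (conjDiagonal P _) *
            Matrix.toEuclideanCLM (𝕜 := ℂ) (conjDiagonal P _)
        rw [← map_mul, conjDiagonal_mul hP]
        congr 2
        funext i
        simp)
  refine (polyEval_eq_algHom ψ (fun k => ?_) p).trans ?_
  · change conjDiagonalOp P _ = _
    congr 1
    funext i
    simp
  · change conjDiagonalOp P _ = _
    congr 1

theorem commute_conjDiagonalOp (hP : IsUnit P.det) (c d : Fin N → ℂ) :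
    Commute (conjDiagonalOp P c) (conjDiagonalOp P d) := by
  change Matrix.toEuclideanCLM (𝕜 := ℂ) _ * Matrix.toEuclideanCLM (𝕜 := ℂ) _ =
    Matrix.toEuclideanCLM (𝕜 := ℂ) _ * Matrix.toEuclideanCLM (𝕜 := ℂ) _
  rw [← map_mul, ← map_mul, conjDiagonal_mul hP, conjDiagonal_mul hP, mul_comm]

theorem continuous_conjDiagonalOp : Continuous (conjDiagonalOp P) :=
  LinearMap.continuous_of_finiteDimensional _

/-- The functional calculus at a tuple of simultaneously diagonalized operators. -/
theorem hasValueAt_conjDiagonalOp_unique (hP : IsUnit P.det) {Ω : Set (Fin n → ℂ)}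
    {f : (Fin n → ℂ) → ℂ} {mu : Fin N → Fin n → ℂ} (hmu : ∀ i, mu i ∈ Ω)
    {X : EuclideanSpace ℂ (Fin N) →L[ℂ] EuclideanSpace ℂ (Fin N)}
    (hX : HasValueAt Ω f (fun k => conjDiagonalOp P fun i => mu i k) X) :
    X = conjDiagonalOp P fun i => f (mu i) := by
  obtain ⟨p, hp, hpX⟩ := hX
  simp only [polyEval_conjDiagonalOp hP] at hpX
  have h : HasSum (fun d i => MvPolynomial.eval (mu i) (p d)) fun i => f (mu i) :=
    Pi.hasSum.2 fun i => hp.2 _ (hmu i)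
  exact hpX.unique (h.map (conjDiagonalOp P) continuous_conjDiagonalOp)

/-- The conjugating matrix (B*)⁻¹ is chosen so that the adjoint has the columns of B as
eigenvectors; their Gram matrix is B*B. -/
theorem adjoint_conjDiagonalOp {B : Matrix (Fin N) (Fin N) ℂ} (hB : IsUnit B.det) (c : Fin N → ℂ) :
    ContinuousLinearMap.adjoint (conjDiagonalOp (Bᴴ)⁻¹ c) =
      conjDiagonalOp B fun i => conj (c i) := by
  change star (Matrix.toEuclideanCLM (𝕜 := ℂ) _) = Matrix.toEuclideanCLM (𝕜 := ℂ) _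
  rw [← map_star]
  congr 1
  have hB' : IsUnit (Bᴴ).det := by rw [Matrix.det_conjTranspose]; exact hB.star
  rw [conjDiagonal, Matrix.nonsing_inv_nonsing_inv _ hB', Matrix.star_eq_conjTranspose,
    Matrix.conjTranspose_mul, Matrix.conjTranspose_mul, Matrix.conjTranspose_conjTranspose,
    Matrix.conjTranspose_nonsing_inv, Matrix.conjTranspose_conjTranspose,
    Matrix.diagonal_conjTranspose, ← Matrix.mul_assoc]
  rfl

end ConjDiagonal

/-! ### Separation by a positive definite matrix -/

open scoped ComplexOrder MatrixOrder in
/-- A Hermitian matrix outside a closed convex cone of Hermitian matrices that contains the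
Gram matrices of rank one is separated from it by a positive definite matrix `Bᴴ * B`. -/
theorem exists_gram_separation {N : ℕ} {C : Set (Fin N → Fin N → ℂ)} (hconv : Convex ℝ C)
    (hclosed : IsClosed C) (hsmul : ∀ X ∈ C, ∀ t : ℝ, ((t : ℂ) * t) • X ∈ C)
    (hherm : ∀ X ∈ C, ∀ i j, conj (X i j) = X j i)
    (hgram : ∀ c : Fin N → ℂ, (fun i j => conj (c i) * c j) ∈ C)
    (hdiag : ∀ X ∈ C, ∀ i, 0 ≤ (X i i).re)
    {D : Fin N → Fin N → ℂ} (hD : ∀ i j, conj (D i j) = D j i) (hDC : D ∉ C) :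
    ∃ B : Matrix (Fin N) (Fin N) ℂ, IsUnit B.det ∧
      (∀ X ∈ C, 0 ≤ (∑ i, ∑ j, (Bᴴ * B) i j * X i j).re) ∧
      (∑ i, ∑ j, (Bᴴ * B) i j * D i j).re < 0 := by
  obtain ⟨f, u, hfu, huD⟩ := RCLike.geometric_hahn_banach_closed_point (𝕜 := ℂ) hconv hclosed hDC
  simp only [RCLike.re_to_complex] at hfu huD
  have h0 : (0 : Fin N → Fin N → ℂ) ∈ C := by
    simpa using hsmul _ (hgram 0) 0
  have hu : 0 < u := by simpa using hfu 0 h0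
  -- If Re f(X) were positive, the multiple of X by u / Re f(X) would reach the value u, which f
  -- stays strictly below on C.
  have hfC : ∀ X ∈ C, (f X).re ≤ 0 := by
    intro X hX
    by_contra! hpos
    have := hfu _ (hsmul X hX √(u / (f X).re))
    rw [← Complex.ofReal_mul, Real.mul_self_sqrt (by positivity), map_smul, smul_eq_mul,
      Complex.re_ofReal_mul, div_mul_cancel₀ _ hpos.ne'] at this
    exact lt_irrefl _ this
  set g : Fin N → Fin N → ℂ := fun i j => -f (Pi.single i (Pi.single j 1)) with hg
  have hfg : ∀ X, -f X = ∑ i, ∑ j, g i j * X i j := by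
    intro X
    have hX : X = ∑ i, ∑ j, X i j • (Pi.single i (Pi.single j 1) : Fin N → Fin N → ℂ) := by
      funext a b
      simp [Finset.sum_apply, Pi.single_apply, ite_apply]
    conv_lhs => rw [hX]
    simp [hg, map_sum, mul_comm]
  -- Passing to the Hermitian part of the coefficients of −f leaves the real part of the pairing
  -- unchanged on Hermitian matrices. Rank-one Gram matrices then show that γ₀ is positive
  -- semidefinite.
  set γ₀ : Matrix (Fin N) (Fin N) ℂ := Matrix.of fun i j => (g i j + conj (g j i)) / 2 with hγ₀
  have hre : ∀ X : Fin N → Fin N → ℂ, (∀ i j, conj (X i j) = X j i) →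
      (∑ i, ∑ j, γ₀ i j * X i j).re = -(f X).re := by
    intro X hX
    have h1 : ∑ i, ∑ j, conj (g j i) * X i j = conj (∑ i, ∑ j, g i j * X i j) := by
      rw [map_sum, Finset.sum_comm]
      simp only [map_sum, map_mul, hX]
    have h2 : ∑ i, ∑ j, γ₀ i j * X i j =
        ((∑ i, ∑ j, g i j * X i j) + conj (∑ i, ∑ j, g i j * X i j)) / 2 := by
      rw [← h1, ← Finset.sum_add_distrib, Finset.sum_div]
      refine Finset.sum_congr rfl fun i _ => ?_
      rw [← Finset.sum_add_distrib, Finset.sum_div]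
      refine Finset.sum_congr rfl fun j _ => ?_
      rw [hγ₀, Matrix.of_apply]
      ring
    rw [h2, Complex.add_conj, ← hfg]
    simp [neg_div]
  have hγ₀h : γ₀.IsHermitian := by
    ext i j
    simp [hγ₀, add_comm]
  have hγ₀p : γ₀.PosSemidef := by
    refine Matrix.PosSemidef.of_dotProduct_mulVec_nonneg hγ₀h fun c => ?_
    have h1 : star c ⬝ᵥ γ₀ *ᵥ c = ∑ i, ∑ j, γ₀ i j * (conj (c i) * c j) := by
      simp only [dotProduct, Matrix.mulVec, Finset.mul_sum, Pi.star_apply]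
      exact Finset.sum_congr rfl fun i _ => Finset.sum_congr rfl fun j _ => mul_left_comm _ _ _
    rw [Complex.nonneg_iff]
    refine ⟨?_, (hγ₀h.im_star_dotProduct_mulVec_self c).symm⟩
    rw [h1, hre _ fun i j => by simp [mul_comm]]
    linarith [hfC _ (hgram c)]
  -- Adding ε times the identity makes γ₀ definite. The pairing stays nonnegative on C by `hdiag`,
  -- and ε is small enough to keep it negative at D.
  obtain ⟨ε, hε, hεD⟩ := exists_pos_mul_lt (hu.trans huD) (∑ i, (D i i).re)
  have hγp : (γ₀ + (ε : ℂ) • (1 : Matrix (Fin N) (Fin N) ℂ)).PosDef :=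
    Matrix.PosDef.posSemidef_add hγ₀p (Matrix.PosDef.one.smul (by exact_mod_cast hε))
  have hreγ : ∀ X : Fin N → Fin N → ℂ, (∀ i j, conj (X i j) = X j i) →
      (∑ i, ∑ j, (γ₀ + (ε : ℂ) • (1 : Matrix (Fin N) (Fin N) ℂ)) i j * X i j).re =
        -(f X).re + (∑ i, (X i i).re) * ε := by
    intro X hX
    rw [← hre X hX]
    simp only [Matrix.add_apply, Matrix.smul_apply, Matrix.one_apply, add_mul,
      Finset.sum_add_distrib, Complex.add_re, smul_eq_mul, mul_ite, mul_one, mul_zero, ite_mul,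
      zero_mul, Finset.sum_ite_eq, Finset.mem_univ, if_true, Complex.re_sum,
      Complex.re_ofReal_mul, Finset.sum_mul, mul_comm ε]
  obtain ⟨B, hB⟩ := CStarAlgebra.nonneg_iff_eq_star_mul_self.1 hγp.posSemidef.nonneg
  rw [Matrix.star_eq_conjTranspose] at hB
  refine ⟨B, ?_, fun X hX => ?_, ?_⟩
  · have := (Matrix.isUnit_iff_isUnit_det _).1 hγp.isUnit
    rw [hB, Matrix.det_mul] at this
    exact isUnit_of_mul_isUnit_right this
  · rw [← hB, hreγ X (hherm X hX)]
    have := mul_nonneg (Finset.sum_nonneg fun i (_ : i ∈ Finset.univ) => hdiag X hX i) hε.le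
    linarith [hfC X hX]
  · rw [← hB, hreγ D hD]
    linarith

/-! ### Necessity of the kernel identity -/

namespace OperatorSpace

universe u

variable {n N : ℕ} {H : Type u} [NormedAddCommGroup H] [InnerProductSpace ℂ H]
  (E : OperatorSpace n H)

/-- A simultaneously diagonalized tuple is completely contractive for `E*` if its Gram matrix is
nonnegative on all Pick kernels of completely contractive tuples. -/
theorem completelyContractive_conjDiagonalOp {lam : Fin N → Fin n → ℂ}
    {B : Matrix (Fin N) (Fin N) ℂ} (hB : IsUnit B.det)
    (h : ∀ X ∈ E.pickCone lam, 0 ≤ (∑ i, ∑ j, (Bᴴ * B) i j * X i j).re) :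
    CompletelyContractive (dualNorms E.norms)
      (fun k => conjDiagonalOp (Bᴴ)⁻¹ fun i => lam i k) := by
  refine E.completelyContractive_dualNorms fun m A hA => ?_
  rw [← tensorNorm_conjTranspose]
  simp only [adjoint_conjDiagonalOp hB]
  change tensorNorm _ (matrixTuple fun k => conjDiagonal B fun i => conj (lam i k)) ≤ 1
  rw [tensorNorm_matrixTuple_le_iff zero_le_one]
  intro x
  rw [one_pow, one_mul]
  -- Expand x = ∑ u_i ⊗ b_i in the basis of columns of B. The adjoint tensor maps it to ∑ T(λ_i)*
  -- u_i ⊗ b_i, with T = A, so the loss of squared norm is the pairing of B*B with the Pick kernel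
  -- of A and u.
  let u : Fin N → EuclideanSpace ℂ (Fin m) := fun i =>
    WithLp.toLp 2 fun a => ∑ t, B⁻¹ i t * x a t
  have hx : ∀ a s, x a s = (∑ i, B s i • u i) a := by
    intro a s
    have : B * B⁻¹ = 1 := Matrix.mul_nonsing_inv B hB
    have h1 : x a s = (B *ᵥ (B⁻¹ *ᵥ x a)) s := by
      rw [Matrix.mulVec_mulVec, this, Matrix.one_mulVec]
    rw [h1]
    simp [Matrix.mulVec, dotProduct, u]
  have hsq : ∀ y : Fin N → EuclideanSpace ℂ (Fin m),
      ∑ a, ∑ s, ‖(∑ i, B s i • y i) a‖ ^ 2 = (∑ i, ∑ j, (Bᴴ * B) i j * ⟪y i, y j⟫_ℂ).re := by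
    intro y
    rw [← sum_norm_sq_matrix_smul, Complex.ofReal_re, Finset.sum_comm]
    simp only [EuclideanSpace.norm_sq_eq]
  have hadj : ∀ i, ContinuousLinearMap.adjoint (∑ k, lam i k • matrixTuple A k) (u i) =
      WithLp.toLp 2 fun a => ∑ b, ∑ k, (A k)ᴴ a b * (conj (lam i k) * u i b) := by
    intro i
    have h1 : ContinuousLinearMap.adjoint (∑ k, lam i k • matrixTuple A k) =
        ∑ k, conj (lam i k) • matrixTuple (fun k => (A k)ᴴ) k := by
      rw [map_sum]
      refine Finset.sum_congr rfl fun k _ => ?_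
      rw [map_smulₛₗ]
      congr 1
      exact (map_star (Matrix.toEuclideanCLM (n := Fin m) (𝕜 := ℂ)) (A k)).symm
    rw [h1]
    ext a
    exact pencil_apply _ _ _
  have hout : ∀ a s, ∑ b, ∑ t, ∑ k, (A k)ᴴ a b *
      conjDiagonal B (fun i => conj (lam i k)) s t * x b t =
      (∑ i, B s i • ContinuousLinearMap.adjoint (∑ k, lam i k • matrixTuple A k) (u i)) a := by
    intro a s
    have h1 : ∀ k b, ∑ t, conjDiagonal B (fun i => conj (lam i k)) s t * x b t =
        ∑ i, B s i * (conj (lam i k) * u i b) := by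
      intro k b
      change (conjDiagonal B (fun i => conj (lam i k)) *ᵥ x b) s = _
      rw [conjDiagonal, ← Matrix.mulVec_mulVec, ← Matrix.mulVec_mulVec,
        Matrix.mulVec, dotProduct]
      refine Finset.sum_congr rfl fun i _ => ?_
      rw [Matrix.mulVec_diagonal]
      rfl
    calc ∑ b, ∑ t, ∑ k, (A k)ᴴ a b * conjDiagonal B (fun i => conj (lam i k)) s t * x b t
        = ∑ b, ∑ k, (A k)ᴴ a b * ∑ t, conjDiagonal B (fun i => conj (lam i k)) s t * x b t := by
          refine Finset.sum_congr rfl fun b _ => ?_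
          rw [Finset.sum_comm]
          simp only [Finset.mul_sum, mul_assoc]
      _ = ∑ b, ∑ k, ∑ i, B s i * ((A k)ᴴ a b * (conj (lam i k) * u i b)) := by
          simp only [h1, Finset.mul_sum, mul_left_comm (B s _)]
      _ = ∑ i, B s i * ∑ b, ∑ k, (A k)ᴴ a b * (conj (lam i k) * u i b) := by
          simp only [Finset.mul_sum]
          rw [Finset.sum_comm (s := (Finset.univ : Finset (Fin N)))]
          exact Finset.sum_congr rfl fun b _ => Finset.sum_comm
      _ = _ := by
          simp only [hadj, WithLp.ofLp_sum, Finset.sum_apply, PiLp.smul_apply, smul_eq_mul]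
  have key := h _ (E.pickKernel_mem_pickCone lam hA u)
  simp only [hout]
  have hL : ∑ a, ∑ s, ‖x a s‖ ^ 2 = ∑ a, ∑ s, ‖(∑ i, B s i • u i) a‖ ^ 2 :=
    Finset.sum_congr rfl fun a _ => Finset.sum_congr rfl fun s _ => by rw [hx]
  rw [hL, hsq, hsq, ← sub_nonneg, ← Complex.sub_re, ← Finset.sum_sub_distrib]
  simpa only [← Finset.sum_sub_distrib, ← mul_sub, pickKernel] using key

/-- The value of a function in the unit ball of `UC^∞(E)` at a simultaneously diagonalized tuple
that is completely contractive for `E*` is a contraction. -/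
theorem norm_conjDiagonalOp_le_one {lam : Fin N → Fin n → ℂ} (hlam : ∀ j, lam j ∈ E.ball)
    {P : Matrix (Fin N) (Fin N) ℂ} (hP : IsUnit P.det)
    (hS : CompletelyContractive (dualNorms E.norms) (fun k => conjDiagonalOp P fun i => lam i k))
    {f : (Fin n → ℂ) → ℂ} (hf : f ∈ E.UCInfty) (hf1 : E.ucNorm f ≤ 1) :
    ‖conjDiagonalOp P fun i => f (lam i)‖ ≤ 1 := by
  -- Test tuples must be strictly contractive, so S is replaced by rS, with joint eigenvalues rλ_i.
  -- Continuity of f at λ_i then allows r → 1.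
  have hr : ∀ r : ℝ, r ∈ Set.Ico (0 : ℝ) 1 →
      ‖conjDiagonalOp P fun i => f ((r : ℂ) • lam i)‖ ≤ 1 := by
    rintro r ⟨hr0, hr1⟩
    have hrn : ‖(r : ℂ)‖ = r := by rw [Complex.norm_real, Real.norm_of_nonneg hr0]
    have htest : E.IsTestTuple (fun k => conjDiagonalOp P fun i => ((r : ℂ) • lam i) k) := by
      refine ⟨fun k l => commute_conjDiagonalOp hP _ _, r, hr0, hr1, fun m A => ?_⟩
      have h1 : (fun k => conjDiagonalOp P fun i => ((r : ℂ) • lam i) k) =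
          fun k => (r : ℂ) • conjDiagonalOp P fun i => lam i k := by
        funext k
        rw [← map_smul]
        rfl
      rw [h1, tensorNorm_smul_right, hrn]
      gcongr
      simpa using hS m A
    obtain ⟨X, hX, -⟩ := hf.2.choose_spec _ _ htest
    have := E.norm_le_ucNorm hf htest hX
    rw [hasValueAt_conjDiagonalOp_unique hP
      (fun i => E.smul_mem_ball (hlam i) (by rw [hrn]; exact hr1.le)) hX] at this
    exact this.trans hf1
  have hlim : Filter.Tendsto (fun r : ℝ => ‖conjDiagonalOp P fun i => f ((r : ℂ) • lam i)‖)
      (nhdsWithin 1 (Set.Iio 1)) (nhds ‖conjDiagonalOp P fun i => f (lam i)‖) := by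
    refine ((continuous_conjDiagonalOp.tendsto _).comp (tendsto_pi_nhds.2 fun i => ?_)).norm
    have hc : ContinuousAt f (lam i) :=
      (hf.1.differentiableAt (E.isOpen_ball.mem_nhds (hlam i))).continuousAt
    have hs : Filter.Tendsto (fun r : ℝ => (r : ℂ) • lam i) (nhdsWithin 1 (Set.Iio 1))
        (nhds (lam i)) := by
      have : Continuous fun r : ℝ => (r : ℂ) • lam i := by fun_prop
      have h1 := this.tendsto 1
      simp only [Complex.ofReal_one, one_smul] at h1
      exact h1.mono_left nhdsWithin_le_nhds
    exact hc.tendsto.comp hs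
  refine le_of_tendsto hlim ?_
  filter_upwards [Ico_mem_nhdsLT (zero_lt_one' ℝ)] with r h
  exact hr r h

/-- The Pick matrix of a function in the unit ball of `UC^∞(E)` is a Pick kernel of a completely
contractive tuple. -/
theorem pick_mem_pickCone {lam : Fin N → Fin n → ℂ} (hlam : ∀ j, lam j ∈ E.ball)
    {f : (Fin n → ℂ) → ℂ} (hf : f ∈ E.UCInfty) (hf1 : E.ucNorm f ≤ 1) :
    (fun i j => 1 - f (lam i) * conj (f (lam j))) ∈ E.pickCone lam := by
  by_contra hD
  -- The zero tuple on ℂ puts the rank-one Gram matrices into the cone.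
  have hzero : CompletelyContractive E.norms (fun _ : Fin n => (0 : ℂ →L[ℂ] ℂ)) := fun m A => by
    refine ((tensorNorm_le_iff le_rfl).2 fun x => ?_).trans (by simpa using E.norms_nonneg A)
    simp
  obtain ⟨B, hB, hpos, hneg⟩ := exists_gram_separation (E.convex_pickCone lam)
    (E.isClosed_pickCone hlam) (fun X hX t => E.smul_mem_pickCone lam hX t)
    (by rintro _ ⟨T, u, -, rfl⟩ i j; exact conj_pickKernel lam T u i j)
    (fun c => by
      have := E.pickKernel_mem_pickCone lam hzero c
      convert this using 1
      funext i j
      simp [pickKernel, mul_comm])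
    (by
      rintro _ ⟨T, u, hT, rfl⟩ i
      refine le_trans ?_ (E.mul_norm_sq_le_re_pickKernel hT lam u i)
      have hlt : ‖∑ k, lam i k • E.gen k‖ < 1 := hlam i
      exact mul_nonneg (by nlinarith [norm_nonneg (∑ k, lam i k • E.gen k)]) (sq_nonneg _))
    (fun i j => by simp [mul_comm]) hD
  have hP : IsUnit ((Bᴴ)⁻¹).det := by
    rw [Matrix.det_nonsing_inv, Matrix.det_conjTranspose]
    exact hB.star.ringInverse
  have hnorm := E.norm_conjDiagonalOp_le_one hlam hP
    (E.completelyContractive_conjDiagonalOp hB hpos) hf hf1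
  rw [← LinearIsometryEquiv.norm_map ContinuousLinearMap.adjoint, adjoint_conjDiagonalOp hB]
    at hnorm
  have h1 : ∀ c : Fin N → ℂ, ‖(WithLp.toLp 2 (B *ᵥ c) : EuclideanSpace ℂ (Fin N))‖ ^ 2 =
      (∑ i, ∑ j, (Bᴴ * B) i j * (conj (c i) * c j)).re := by
    intro c
    have := sum_norm_sq_matrix_smul B c
    rw [EuclideanSpace.norm_sq_eq, ← Complex.ofReal_re (∑ a, _)]
    refine congrArg Complex.re (Eq.trans this ?_)
    simp [mul_comm]
  have h2 : conjDiagonalOp B (fun i => conj (f (lam i))) (WithLp.toLp 2 (B *ᵥ 1)) =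
      WithLp.toLp 2 (B *ᵥ fun i => conj (f (lam i))) := by
    change Matrix.toEuclideanCLM (𝕜 := ℂ) _ _ = _
    rw [Matrix.toEuclideanCLM_toLp, conjDiagonal, Matrix.mulVec_mulVec, Matrix.mul_assoc,
      Matrix.nonsing_inv_mul B hB, Matrix.mul_one, ← Matrix.mulVec_mulVec]
    congr 2
    funext i
    simp [Matrix.mulVec_diagonal]
  -- Contractivity of f(S)* at ∑ b_i = B·1 reads ∑ (B*B)_ij (1 − f(λ_i) conj f(λ_j)) ≥ 0, contrary
  -- to `hneg`.
  have h3 := ContinuousLinearMap.le_of_opNorm_le _ hnorm (WithLp.toLp 2 (B *ᵥ 1))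
  rw [h2, one_mul] at h3
  have h4 := pow_le_pow_left₀ (norm_nonneg _) h3 2
  rw [h1, h1, ← sub_nonneg, ← Complex.sub_re, ← Finset.sum_sub_distrib] at h4
  refine hneg.not_ge (h4.trans_eq (congrArg Complex.re ?_))
  refine Finset.sum_congr rfl fun i _ => ?_
  rw [← Finset.sum_sub_distrib]
  refine Finset.sum_congr rfl fun j _ => ?_
  simp only [Pi.one_apply, map_one, Complex.conj_conj]
  ring

/-- The Hilbert space vectors u_i are the adjoints of the row vectors v_i, whence the `star`. -/
theorem pickKernel_matrixTuple {m : ℕ} (lam : Fin N → Fin n → ℂ)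
    (T : Fin n → Matrix (Fin m) (Fin m) ℂ) (v : Fin N → Fin m → ℂ) (i j : Fin N) :
    pickKernel lam (matrixTuple T) (fun i => WithLp.toLp 2 (star (v i))) i j =
      v i ⬝ᵥ ((1 - ∑ k, ∑ l, (lam i k * conj (lam j l)) • (T k * (T l)ᴴ)) *ᵥ star (v j)) := by
  have hadj : ∀ i, ContinuousLinearMap.adjoint (∑ k, lam i k • matrixTuple T k)
      (WithLp.toLp 2 (star (v i))) =
        WithLp.toLp 2 ((∑ k, lam i k • T k)ᴴ *ᵥ star (v i)) := by
    intro i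
    have h1 : ∑ k, lam i k • matrixTuple T k =
        Matrix.toEuclideanCLM (𝕜 := ℂ) (∑ k, lam i k • T k) := by
      simp [matrixTuple]
    rw [h1, ← Matrix.toEuclideanCLM_toLp, ← Matrix.star_eq_conjTranspose, map_star]
    rfl
  rw [sum_sum_smul_mul_conjTranspose]
  simp only [pickKernel, hadj, EuclideanSpace.inner_toLp_toLp]
  rw [Matrix.sub_mulVec, Matrix.one_mulVec, dotProduct_sub, ← Matrix.mulVec_mulVec,
    Matrix.dotProduct_mulVec, star_star, dotProduct_comm, dotProduct_comm (_ *ᵥ _)]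
  simp [← Matrix.star_vecMul]

end OperatorSpace

end OpSpace

end

theorem theoremT {n N : ℕ} {H : Type*} [NormedAddCommGroup H] [InnerProductSpace ℂ H]
    [CompleteSpace H] (E : OpSpace.OperatorSpace n H)
    (lam : Fin N → Fin n → ℂ) (hlam : ∀ j, lam j ∈ E.ball) (w : Fin N → ℂ) :
    (∃ f ∈ E.UCInfty, E.ucNorm f ≤ 1 ∧ ∀ j, f (lam j) = w j) ↔
      ∃ (m : ℕ) (T : Fin n → Matrix (Fin m) (Fin m) ℂ) (v : Fin N → Fin m → ℂ),
        OpSpace.CompletelyContractive E.norms (OpSpace.matrixTuple T) ∧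
        ∀ i j, 1 - w i * conj (w j) =
          v i ⬝ᵥ ((1 - ∑ k, ∑ l, (lam i k * conj (lam j l)) • (T k * (T l)ᴴ)) *ᵥ star (v j)) := by
  constructor
  · rintro ⟨f, hf, hf1, hfw⟩
    obtain ⟨T, u, hT, hTu⟩ := E.pick_mem_pickCone hlam hf hf1
    have hTm : OpSpace.matrixTuple (fun k => (Matrix.toEuclideanCLM (𝕜 := ℂ)).symm (T k)) = T := by
      funext k
      exact (Matrix.toEuclideanCLM (𝕜 := ℂ)).apply_symm_apply (T k)
    refine ⟨N + N, fun k => (Matrix.toEuclideanCLM (𝕜 := ℂ)).symm (T k),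
      fun i => star (u i).ofLp, by rwa [hTm], fun i j => ?_⟩
    refine Eq.trans ?_ (OpSpace.OperatorSpace.pickKernel_matrixTuple lam _
      (fun i => star (u i).ofLp) i j)
    rw [hTm]
    simp only [star_star, WithLp.toLp_ofLp]
    simp only [hTu, hfw]
  · rintro ⟨m, T, v, hT, h⟩
    exact E.exists_mem_unitBall_of_kernel hlam hT h
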